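/- All graphs are finite, simple and undirected. For a graph $G=(V,E)$, a vertex $x$ and an integer $k\ge 0$, let $B_G(x,k)$ be the set of vertices at distance at most $k$ from $x$ in $G$ (the distance is $+\infty$ between different components). For an integer $\ell\ge 0$, let $\nu_\ell$ be the maximum number of pairwise disjoint members of $\{B_G(x,\ell) : x\in V\}$, and let $\tau_\ell$ be the minimum size of a set of vertices that intersects every $B_G(x,\ell)$, $x\in V$. A set $X\subseteq V$ is 2-shattered in $G$ if for every $Y\subseteq X$ with $|Y|=2$ there are $x\in V$ and $k\ge 0$ with $B_G(x,k)\cap X=Y$. The distance 2VC-dimension of $G$ is the maximum, over all induced subgraphs $G'$ of $G$, of the size of a set that is 2-shattered in $G'$ (distances being taken in $G'$). **Corollary.** (a) Let $d\ge 0$ be an integer. For every graph $G$ of distance 2VC-dimension at most $d$ and every integer $\ell\ge 0$, $$\tau_\ell \;\le\; 11\cdot d^2\cdot (d+\nu_\ell+3)\cdot\binom{d+\nu_\ell}{d}^2 .$$ (b) For every fixed $d$ this bound is a polynomial in $\nu_\ell$, of degree at most $2d+1$: there is a polynomial $p_d\in\mathbb{Q}[t]$ with $\deg p_d\le 2d+1$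 and $p_d(n)=11 d^2(d+n+3)\binom{d+n}{d}^2$ for all integers $n\ge 0$. (c) For every integer $\ell\ge 0$, every planar graph $G$ of diameter at most $2\ell$ has a set $D$ of at most $35200$ vertices such that every vertex of $G$ is at distance at most $\ell$ from a vertex of $D$. -/

import Mathlib

namespace Hypergraph

variable {α : Type*}

/-- `X` is a hitting set: a set of vertices that meets every hyperedge. -/
def IsHittingSet (H : Hypergraph α) (X : Set α) : Prop :=
  X ⊆ H.vertexSet ∧ ∀ e ∈ H.edgeSet, (e ∩ X).Nonempty

/-- `M` is a set of pairwise disjoint hyperedges. -/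
def IsPacking (H : Hypergraph α) (M : Set (Set α)) : Prop :=
  M ⊆ H.edgeSet ∧ M.PairwiseDisjoint id

/-- `X` is 2-shattered: every subset of `X` of size 2 is the trace of a hyperedge on `X`. -/
def IsTwoShattered (H : Hypergraph α) (X : Set α) : Prop :=
  X ⊆ H.vertexSet ∧ ∀ Y ⊆ X, Y.ncard = 2 → ∃ e ∈ H.edgeSet, e ∩ X = Y

/-- The transversality `τ`: the minimum size of a hitting set. It is used only for hypergraphs
on finitely many vertices without empty hyperedge, for which a hitting set exists. -/
noncomputable def transversality (H : Hypergraph α) : ℕ :=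
  sInf {n | ∃ X : Finset α, H.IsHittingSet ↑X ∧ X.card = n}

/-- The packing number `ν`: the maximum number of pairwise disjoint hyperedges. It is used only
for hypergraphs on finitely many vertices, for which the maximum exists. -/
noncomputable def packingNumber (H : Hypergraph α) : ℕ :=
  sSup {n | ∃ M : Finset (Set α), H.IsPacking ↑M ∧ M.card = n}

/-- The 2VC-dimension: the maximum size of a 2-shattered set. It is used only for hypergraphs
on finitely many vertices, for which the maximum exists. -/
noncomputable def twoVCDim (H : Hypergraph α) : ℕ :=
  sSup {n | ∃ X : Finset α, H.IsTwoShattered ↑X ∧ X.card = n}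

end Hypergraph

namespace SimpleGraph

variable {V : Type*}

/-- The ball `B(x, k)`: all vertices at distance at most `k` from `x`, where the distance between
vertices of different components is infinite. -/
def distBall (G : SimpleGraph V) (x : V) (k : ℕ) : Set V :=
  {y | G.edist x y ≤ k}

/-- The `B_ℓ`-hypergraph of `G`: its hyperedges are the balls of radius `ℓ`. -/
def ballHypergraph (G : SimpleGraph V) (l : ℕ) : Hypergraph V where
  vertexSet := Set.univ
  edgeSet := {e | ∃ x, e = G.distBall x l}
  subset_vertexSet_of_mem_edgeSet' := fun _ _ => Set.subset_univ _

/-- The `B`-hypergraph of `G`: its hyperedges are the balls of all radii. -/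
def allBallsHypergraph (G : SimpleGraph V) : Hypergraph V where
  vertexSet := Set.univ
  edgeSet := {e | ∃ x l, e = G.distBall x l}
  subset_vertexSet_of_mem_edgeSet' := fun _ _ => Set.subset_univ _

/-- The distance 2VC-dimension of a finite graph `G`: the maximum, over all induced subgraphs of `G`,
of the 2VC-dimension of the `B`-hypergraph of the subgraph (so that distances are taken inside the
subgraph). -/
noncomputable def distTwoVCDim (G : SimpleGraph V) : ℕ :=
  ⨆ S : Set V, (G.induce S).allBallsHypergraph.twoVCDim

/-- `D` is a dominating set of `G` at distance `ℓ`. -/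
def IsDominatingAt (G : SimpleGraph V) (l : ℕ) (D : Set V) : Prop :=
  ∀ v, ∃ x ∈ D, G.edist x v ≤ l

/-- `A` is a (simple) arc in the Euclidean plane with endpoints `a` and `b`: the image of an
injective continuous path from `a` to `b`. -/
def IsPlaneArc (A : Set (EuclideanSpace ℝ (Fin 2))) (a b : EuclideanSpace ℝ (Fin 2)) : Prop :=
  ∃ γ : _root_.Path a b, Function.Injective γ ∧ Set.range γ = A

/-- A crossing-free drawing of `G` in the Euclidean plane. -/
structure PlaneEmbedding (G : SimpleGraph V) where
  /-- The points that represent the vertices. -/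
  point : V → EuclideanSpace ℝ (Fin 2)
  /-- The arcs that represent the edges. -/
  arc : G.edgeSet → Set (EuclideanSpace ℝ (Fin 2))
  /-- Distinct vertices are distinct points. -/
  point_injective : Function.Injective point
  /-- The edge `uv` is drawn as an arc between the points of `u` and `v`. -/
  isPlaneArc : ∀ (u v : V) (h : s(u, v) ∈ G.edgeSet),
    IsPlaneArc (arc ⟨s(u, v), h⟩) (point u) (point v)
  /-- The arc of an edge contains the points of no other vertices than the ends of the edge. -/
  mem_of_point_mem : ∀ (e : G.edgeSet) (w : V), point w ∈ arc e → w ∈ (e : Sym2 V)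
  /-- The arcs of two distinct edges meet only in points of common ends of these edges. -/
  inter_subset : ∀ e f : G.edgeSet, e ≠ f →
    arc e ∩ arc f ⊆ point '' {w | w ∈ (e : Sym2 V) ∧ w ∈ (f : Sym2 V)}

/-- A graph is planar if it can be drawn in the plane without crossings. -/
def IsPlanar (G : SimpleGraph V) : Prop :=
  Nonempty G.PlaneEmbedding

end SimpleGraph

/-!
The balls of radius `ℓ` are a set system that is its own dual, since `y` lies in the ball around `x`
if and only if `x` lies in the ball around `y`. So a bound `d` on the 2VC-dimension says that among
any `d + 1` balls there are two without a private common vertex, that is, one that lies in no other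
of these balls. For set systems of this kind Ding, Seymour and Winkler bound `τ` in terms of `d` and
`ν`. By the minimax theorem, either a probability distribution on the sets gives every vertex a
small load, or a probability distribution on the vertices gives every set a large weight. In the
first case, a random sample of sets contains `(d + ν).choose d` of them such that no common vertex
of two lies in a third one; by Ramsey's theorem `ν + 1` of these are disjoint or `d + 1` of them
meet pairwise, and both are impossible. In the second case, the ε-net theorem yields a small hitting
set, as the VC-dimension is less than `(d + 1).choose 2`.

In a planar graph one can take `d = 4`: five vertices of which every two are cut out by a ball would
be joined pairwise by walks through the centres of these balls such that walks between disjoint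
pairs do not meet, a drawing of `K₅`. Such a drawing does not exist: continuous square roots of
`z - p` along the edges yield the parity of the winding number of each triangle around the other two
vertices, as a sign. The sign is the same for both vertices, while its product over the four
triangles of any four vertices is `-1`; multiplying over all five quadruples counts every triangle
twice and gives `1 = -1`. If the diameter is at most `2ℓ`, any two balls meet, so `ν ≤ 1`.
-/

/-! ### Drawings of `K₅` in the plane -/

/-- Sign data of a drawing of a complete graph on `ι` with vertices at `p` in which no two disjoint
edges meet: `ρ i j k` is the quotient of the end values of a continuous square root of `z - p k`
along the edge from `i` to `j`. The exchange rule comes from a continuous square root of `z - w` for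
`z` on the edge `ij` and `w` on the edge `kl`. -/
structure IsRootRatio {ι F : Type*} [Field F] (p : ι → F) (ρ : ι → ι → ι → F) : Prop where
  injective : Function.Injective p
  sq : ∀ i j k, [i, j, k].Nodup → ρ i j k ^ 2 = (p j - p k) / (p i - p k)
  exchange : ∀ i j k l, [i, j, k, l].Nodup → ρ i j k * ρ k l j = ρ k l i * ρ i j l

namespace IsRootRatio

variable {ι F : Type*} [Field F] {p : ι → F} {ρ : ι → ι → ι → F} {a b c d l m : ι}

theorem sub_ne_zero (h : IsRootRatio p ρ) (hab : a ≠ b) : p a - p b ≠ 0 :=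
  _root_.sub_ne_zero.2 (h.injective.ne hab)

theorem ne_zero (h : IsRootRatio p ρ) (hn : [a, b, c].Nodup) : ρ a b c ≠ 0 := by
  have hsq := h.sq a b c hn
  simp only [List.nodup_cons, List.mem_cons, List.not_mem_nil, or_false, not_or] at hn
  intro h0
  rw [h0, zero_pow two_ne_zero, eq_comm, div_eq_zero_iff] at hsq
  exact hsq.elim (h.sub_ne_zero hn.2.1) (h.sub_ne_zero hn.1.2)

/-- The sign with which a continuous square root of `z - p l` returns after one turn around the
triangle `abc`, that is, the parity of the winding number of the triangle around `p l`. -/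
def triangleSign (ρ : ι → ι → ι → F) (a b c l : ι) : F :=
  ρ a b l * ρ b c l / ρ a c l

theorem triangleSign_sq (h : IsRootRatio p ρ) (hn : [a, b, c, l].Nodup) :
    triangleSign ρ a b c l ^ 2 = 1 := by
  have hab := h.sq a b l (by grind)
  have hbc := h.sq b c l (by grind)
  have hac := h.sq a c l (by grind)
  have hal := h.sub_ne_zero (a := a) (b := l) (by grind)
  have hbl := h.sub_ne_zero (a := b) (b := l) (by grind)
  have hcl := h.sub_ne_zero (a := c) (b := l) (by grind)
  rw [triangleSign, div_pow, mul_pow, hab, hbc, hac]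
  field_simp

theorem triangleSign_congr (h : IsRootRatio p ρ) (hn : [a, b, c, l, m].Nodup) :
    triangleSign ρ a b c l = triangleSign ρ a b c m := by
  have hab := h.exchange a b l m (by grind)
  have hbc := h.exchange b c l m (by grind)
  have hac := h.exchange a c l m (by grind)
  have := h.ne_zero (a := a) (b := c) (c := l) (by grind)
  have := h.ne_zero (a := a) (b := c) (c := m) (by grind)
  have hb := h.ne_zero (a := l) (b := m) (c := b) (by grind)
  have hc := h.ne_zero (a := l) (b := m) (c := c) (by grind)
  rw [triangleSign, triangleSign, div_eq_div_iff ‹_› ‹_›]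
  apply mul_right_cancel₀ (mul_ne_zero hb hc)
  linear_combination ρ b c l * ρ l m c * ρ a c m * hab +
    ρ l m a * ρ a b m * ρ a c m * hbc - ρ a b m * ρ b c m * ρ l m b * hac

theorem triangleSign_mul_of_four (h : IsRootRatio p ρ) (hn : [a, b, c, d].Nodup) :
    triangleSign ρ a b c d * triangleSign ρ a b d c * triangleSign ρ a c d b *
      triangleSign ρ b c d a = -1 := by
  have hsq : (ρ a c b * ρ b d c) ^ 2 = -(ρ a d b * ρ b c d) ^ 2 := by
    rw [mul_pow, mul_pow, h.sq a c b (by grind), h.sq b d c (by grind), h.sq a d b (by grind),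
      h.sq b c d (by grind), ← neg_sub (p b) (p c), ← neg_sub (p c) (p d), ← neg_sub (p b) (p d)]
    have := h.sub_ne_zero (a := a) (b := b) (by grind)
    have := h.sub_ne_zero (a := b) (b := c) (by grind)
    have := h.sub_ne_zero (a := b) (b := d) (by grind)
    field_simp
  have hneg : triangleSign ρ a b d c * triangleSign ρ a c d b =
      -(triangleSign ρ a b c d * triangleSign ρ b c d a) := by
    have h₁ := h.exchange a b c d hn
    have h₂ := h.exchange a c b d (by grind)
    have h₃ := h.exchange a d b c (by grind)
    have := h.ne_zero (a := a) (b := d) (c := c) (by grind)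
    have := h.ne_zero (a := a) (b := d) (c := b) (by grind)
    have := h.ne_zero (a := a) (b := c) (c := d) (by grind)
    have := h.ne_zero (a := b) (b := d) (c := a) (by grind)
    simp only [triangleSign]
    field_simp
    linear_combination ρ a c b * ρ b d c * ρ a c d * ρ b d a * h₁ +
      ρ c d a * ρ a b d * (hsq - ρ a c b * ρ b d c * h₂ - ρ a d b * ρ b c d * h₃)
  have habc := h.triangleSign_sq hn
  have hbcd := h.triangleSign_sq (a := b) (b := c) (c := d) (l := a) (by grind)
  linear_combination triangleSign ρ a b c d * triangleSign ρ b c d a * hneg -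
    triangleSign ρ b c d a ^ 2 * habc - hbcd

/-- The five quadruples of `Fin 5` contain each of the ten triangles twice. -/
theorem false_of_fin_five {p : Fin 5 → F} {ρ : Fin 5 → Fin 5 → Fin 5 → F}
    (h : IsRootRatio p ρ) (h2 : (2 : F) ≠ 0) : False := by
  let ε : Fin 5 → Fin 5 → Fin 5 → Fin 5 → F := triangleSign ρ
  have hε : ∀ a b c l m, [a, b, c, l, m].Nodup → ε a b c m = ε a b c l :=
    fun a b c l m hn ↦ (h.triangleSign_congr hn).symm
  have hsq : ∀ a b c l, [a, b, c, l].Nodup → ε a b c l ^ 2 = 1 :=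
    fun a b c l hn ↦ h.triangleSign_sq hn
  have hquad : ∀ a b c d, [a, b, c, d].Nodup →
      ε a b c d * ε a b d c * ε a c d b * ε b c d a = -1 :=
    fun a b c d hn ↦ h.triangleSign_mul_of_four hn
  have h₀ := hquad 1 2 3 4 (by decide)
  have h₁ := hquad 0 2 3 4 (by decide)
  have h₂ := hquad 0 1 3 4 (by decide)
  have h₃ := hquad 0 1 2 4 (by decide)
  have h₄ := hquad 0 1 2 3 (by decide)
  rw [hε 1 2 3 0 4 (by decide), hε 1 2 4 0 3 (by decide), hε 1 3 4 0 2 (by decide),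
    hε 2 3 4 0 1 (by decide)] at h₀
  rw [hε 0 2 3 1 4 (by decide), hε 0 2 4 1 3 (by decide), hε 0 3 4 1 2 (by decide)] at h₁
  rw [hε 0 1 3 2 4 (by decide), hε 0 1 4 2 3 (by decide)] at h₂
  rw [hε 0 1 2 3 4 (by decide)] at h₃
  have hall : (ε 0 1 2 3 * ε 0 1 3 2 * ε 0 1 4 2 * ε 0 2 3 1 * ε 0 2 4 1 * ε 0 3 4 1 * ε 1 2 3 0 *
      ε 1 2 4 0 * ε 1 3 4 0 * ε 2 3 4 0) ^ 2 = (-1) ^ 5 := by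
    calc _ = (ε 1 2 3 0 * ε 1 2 4 0 * ε 1 3 4 0 * ε 2 3 4 0) *
        (ε 0 2 3 1 * ε 0 2 4 1 * ε 0 3 4 1 * ε 2 3 4 0) *
        (ε 0 1 3 2 * ε 0 1 4 2 * ε 0 3 4 1 * ε 1 3 4 0) *
        (ε 0 1 2 3 * ε 0 1 4 2 * ε 0 2 4 1 * ε 1 2 4 0) *
        (ε 0 1 2 3 * ε 0 1 3 2 * ε 0 2 3 1 * ε 1 2 3 0) := by ring
      _ = (-1) ^ 5 := by rw [h₀, h₁, h₂, h₃, h₄]; ring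
  simp (disch := decide) only [mul_pow, hsq, mul_one] at hall
  exact h2 (by linear_combination hall)

end IsRootRatio

theorem div_eq_div_of_sq_eq_mul_sq {A 𝕜 : Type*} [TopologicalSpace A] [PreconnectedSpace A]
    [Field 𝕜] [TopologicalSpace 𝕜] [T1Space 𝕜] [ContinuousInv₀ 𝕜] [ContinuousMul 𝕜] {g h : A → 𝕜}
    (hg : Continuous g) (hh : Continuous h) (hg0 : ∀ a, g a ≠ 0) (hh0 : ∀ a, h a ≠ 0) {c : 𝕜}
    (hsq : ∀ a, h a ^ 2 = c * g a ^ 2) (x y : A) : h x / h y = g x / g y := by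
  have heq : Set.EqOn (fun a ↦ h a * g y) (fun a ↦ g a * h y) Set.univ :=
    isPreconnected_univ.eq_of_sq_eq (by fun_prop) (by fun_prop)
      (fun a _ ↦ by simp only [Pi.pow_apply, mul_pow, hsq]; ring)
      (fun _ ↦ mul_ne_zero (hg0 _) (hh0 _)) (Set.mem_univ y) (mul_comm _ _)
  exact (div_eq_div_iff (hh0 y) (hg0 y)).2 (heq (Set.mem_univ x))

theorem exists_continuous_sq_eq {A : Type*} [TopologicalSpace A] [SimplyConnectedSpace A]
    [LocallyPathConnectedSpace A] {f : A → ℂ} (hf : Continuous f) (hf0 : ∀ a, f a ≠ 0) :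
    ∃ g : A → ℂ, Continuous g ∧ ∀ a, g a ^ 2 = f a := by
  have huniv : IsSimplyConnected (Set.univ : Set A) :=
    (Homeomorph.Set.univ A).toHomotopyEquiv.simplyConnectedSpace
  simpa only [continuousOn_univ] using Complex.exists_continuousOn_pow_eq huniv isOpen_univ
    hf.continuousOn (by simpa using hf0) two_ne_zero

/-- Both sides are the quotient of the end values of a continuous square root of `γ s - δ t`, along
two paths in the square from `(0, 0)` to `(1, 1)`. -/
theorem sqrt_ratio_exchange {γ δ : ℝ → ℂ} (hγ : Continuous γ) (hδ : Continuous δ)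
    (hne : ∀ s t, γ s ≠ δ t) {r₁ r₂ r₃ r₄ : ℝ → ℂ} (hr₁ : Continuous r₁) (hr₂ : Continuous r₂)
    (hr₃ : Continuous r₃) (hr₄ : Continuous r₄) (h₁ : ∀ s, r₁ s ^ 2 = γ s - δ 0)
    (h₂ : ∀ t, r₂ t ^ 2 = δ t - γ 1) (h₃ : ∀ t, r₃ t ^ 2 = δ t - γ 0)
    (h₄ : ∀ s, r₄ s ^ 2 = γ s - δ 1) :
    r₁ 1 / r₁ 0 * (r₂ 1 / r₂ 0) = r₃ 1 / r₃ 0 * (r₄ 1 / r₄ 0) := by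
  obtain ⟨G, hG, hGsq⟩ := exists_continuous_sq_eq (A := ℝ × ℝ) (f := fun x ↦ γ x.1 - δ x.2)
    (by fun_prop) fun x ↦ sub_ne_zero.2 (hne _ _)
  have hG0 : ∀ x, G x ≠ 0 := fun x h0 ↦ hne x.1 x.2 <| sub_eq_zero.1 <| by
    rw [← hGsq, h0, zero_pow two_ne_zero]
  have hside : ∀ {u : ℝ → ℝ × ℝ} {r : ℝ → ℂ} {c : ℂ}, Continuous u → Continuous r → c ≠ 0 →
      (∀ s, r s ^ 2 = c * (γ (u s).1 - δ (u s).2)) → r 1 / r 0 = G (u 1) / G (u 0) := by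
    intro u r c hu hr hc hsq
    refine div_eq_div_of_sq_eq_mul_sq (hG.comp hu) hr (fun s ↦ hG0 _) (fun s h0 ↦ ?_)
      (fun s ↦ (hsq s).trans (by rw [Function.comp_apply, hGsq])) 1 0
    have := hsq s
    rw [h0, zero_pow two_ne_zero, eq_comm] at this
    exact mul_ne_zero hc (sub_ne_zero.2 (hne _ _)) this
  rw [hside (u := fun s ↦ (s, 0)) (by fun_prop) hr₁ one_ne_zero (by simpa using h₁),
    hside (u := fun t ↦ (1, t)) (by fun_prop) hr₂ (neg_ne_zero.2 one_ne_zero) (by simpa using h₂),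
    hside (u := fun t ↦ (0, t)) (by fun_prop) hr₃ (neg_ne_zero.2 one_ne_zero) (by simpa using h₃),
    hside (u := fun s ↦ (s, 1)) (by fun_prop) hr₄ one_ne_zero (by simpa using h₄)]
  have := hG0 (0, 0)
  have := hG0 (1, 0)
  have := hG0 (0, 1)
  field_simp

theorem exists_isRootRatio {ι : Type*} {p : ι → ℂ} (hp : p.Injective) {γ : ι → ι → ℝ → ℂ}
    (hγ : ∀ i j, Continuous (γ i j)) (hends : ∀ i j, i ≠ j → γ i j 0 = p i ∧ γ i j 1 = p j)
    (hpt : ∀ i j k, [i, j, k].Nodup → ∀ s, γ i j s ≠ p k)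
    (hne : ∀ i j k l, [i, j, k, l].Nodup → ∀ s t, γ i j s ≠ γ k l t) :
    ∃ ρ, IsRootRatio p ρ := by
  have hr : ∀ i j k, ∃ r : ℝ → ℂ, Continuous r ∧
      ([i, j, k].Nodup → ∀ s, r s ^ 2 = γ i j s - p k) := by
    intro i j k
    by_cases hn : [i, j, k].Nodup
    · obtain ⟨r, hr, hsq⟩ := exists_continuous_sq_eq (f := fun s ↦ γ i j s - p k)
        ((hγ i j).sub continuous_const) fun s ↦ sub_ne_zero.2 (hpt i j k hn s)
      exact ⟨r, hr, fun _ ↦ hsq⟩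
    · exact ⟨0, continuous_zero, fun h ↦ absurd h hn⟩
  choose r hrc hr using hr
  refine ⟨fun i j k ↦ r i j k 1 / r i j k 0, hp, fun i j k hn ↦ ?_, fun i j k l hn ↦ ?_⟩
  · obtain ⟨h₀, h₁⟩ := hends i j (by grind)
    rw [div_pow, hr i j k hn, hr i j k hn, h₀, h₁]
  · obtain ⟨hij₀, hij₁⟩ := hends i j (by grind)
    obtain ⟨hkl₀, hkl₁⟩ := hends k l (by grind)
    exact sqrt_ratio_exchange (hγ i j) (hγ k l) (hne i j k l hn) (hrc i j k) (hrc k l j)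
      (hrc k l i) (hrc i j l) (by rw [hkl₀]; exact hr i j k (by grind))
      (by rw [hij₁]; exact hr k l j (by grind)) (by rw [hij₀]; exact hr k l i (by grind))
      (by rw [hkl₁]; exact hr i j l (by grind))

theorem exists_disjoint_edges_meet {p : Fin 5 → ℂ} {A : Fin 5 → Fin 5 → Set ℂ}
    (hA : ∀ i j, i ≠ j → JoinedIn (A i j) (p i) (p j)) :
    ∃ i j k l, [i, j, k, l].Nodup ∧ (A i j ∩ A k l).Nonempty := by
  by_contra! hdisj
  have hγ : ∀ i j, ∃ γ : ℝ → ℂ, Continuous γ ∧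
      (i ≠ j → γ 0 = p i ∧ γ 1 = p j ∧ ∀ t, γ t ∈ A i j) := by
    intro i j
    obtain rfl | hij := eq_or_ne i j
    · exact ⟨0, continuous_zero, fun h ↦ absurd rfl h⟩
    · obtain ⟨γ, hγ⟩ := hA i j hij
      exact ⟨γ.extend, γ.continuous_extend, fun _ ↦ ⟨γ.extend_zero, γ.extend_one, fun t ↦ hγ _⟩⟩
  choose γ hγc hγ using hγ
  have hne : ∀ i j k l, [i, j, k, l].Nodup → ∀ s t, γ i j s ≠ γ k l t := by
    intro i j k l hn s t hst
    refine Set.eq_empty_iff_forall_notMem.1 (hdisj i j k l hn) (γ i j s)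
      ⟨(hγ i j (by grind)).2.2 s, ?_⟩
    rw [hst]
    exact (hγ k l (by grind)).2.2 t
  have hpt : ∀ i j k, [i, j, k].Nodup → ∀ s, γ i j s ≠ p k := by
    intro i j k hn s
    obtain ⟨l, hl⟩ : ∃ l, [i, j, k, l].Nodup := by decide +revert
    rw [← (hγ k l (by grind)).1]
    exact hne i j k l hl s 0
  have hinj : p.Injective := by
    intro i k hik
    by_contra hne'
    obtain ⟨j, hj⟩ : ∃ j, [i, j, k].Nodup := by clear hik; decide +revert
    exact hpt i j k hj 0 ((hγ i j (by grind)).1.trans hik)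
  obtain ⟨ρ, hρ⟩ := exists_isRootRatio hinj hγc
    (fun i j hij ↦ ⟨(hγ i j hij).1, (hγ i j hij).2.1⟩) hpt hne
  exact hρ.false_of_fin_five two_ne_zero

/-! ### Balls in planar graphs -/

section Planar

variable {V : Type*} {G : SimpleGraph V}

theorem edist_add_edist_le_length {u v w : V} (p : G.Walk u v) (hw : w ∈ p.support) :
    G.edist u w + G.edist w v ≤ p.length := by
  classical
  rw [← p.take_spec hw, SimpleGraph.Walk.length_append, Nat.cast_add]
  exact add_le_add (SimpleGraph.edist_le _) (SimpleGraph.edist_le _)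

/-- The walk follows two shortest walks from `z`. -/
theorem exists_walk_forall_edist_add_edist_le {l : ℕ} {x y z : V} (hx : G.edist z x ≤ l)
    (hy : G.edist z y ≤ l) :
    ∃ q : G.Walk x y, ∀ w ∈ q.support,
      G.edist z w + G.edist w x ≤ l ∨ G.edist z w + G.edist w y ≤ l := by
  have hgeodesic : ∀ {u}, G.edist z u ≤ l → ∃ p : G.Walk z u, (p.length : ℕ∞) = G.edist z u :=
    fun h ↦ SimpleGraph.exists_walk_of_edist_ne_top (ne_top_of_le_ne_top (ENat.natCast_ne_top l) h)
  obtain ⟨p, hp⟩ := hgeodesic hx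
  obtain ⟨q, hq⟩ := hgeodesic hy
  refine ⟨p.reverse.append q, fun w hw ↦ ?_⟩
  rw [SimpleGraph.Walk.mem_support_append_iff, SimpleGraph.Walk.support_reverse,
    List.mem_reverse] at hw
  exact hw.imp (fun hw ↦ (edist_add_edist_le_length p hw).trans (hp.trans_le hx))
    fun hw ↦ (edist_add_edist_le_length q hw).trans (hq.trans_le hy)

theorem edist_le_or_edist_le_of_add_le {l : ℕ∞} {w x x' z z' : V}
    (h : G.edist z w + G.edist w x ≤ l) (h' : G.edist z' w + G.edist w x' ≤ l) :
    G.edist z x' ≤ l ∨ G.edist z' x ≤ l := by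
  rcases le_total (G.edist w x) (G.edist w x') with hle | hle
  · exact .inr (G.edist_triangle.trans ((add_le_add_right hle _).trans h'))
  · exact .inl (G.edist_triangle.trans ((add_le_add_right hle _).trans h))

/-- The part of the plane covered by the subgraph of `G` induced on `S`. -/
def inducedDrawing (E : G.PlaneEmbedding) (S : Set V) : Set (EuclideanSpace ℝ (Fin 2)) :=
  E.point '' S ∪ ⋃ (e : G.edgeSet) (_ : ∀ w ∈ (e : Sym2 V), w ∈ S), E.arc e

theorem mem_inducedDrawing {E : G.PlaneEmbedding} {S : Set V} {a : EuclideanSpace ℝ (Fin 2)} :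
    a ∈ inducedDrawing E S ↔
      (∃ w ∈ S, E.point w = a) ∨ ∃ e : G.edgeSet, (∀ w ∈ (e : Sym2 V), w ∈ S) ∧ a ∈ E.arc e := by
  simp only [inducedDrawing, Set.mem_union, Set.mem_image, Set.mem_iUnion, exists_prop]

theorem joinedIn_inducedDrawing (E : G.PlaneEmbedding) {S : Set V} {u v : V} (q : G.Walk u v)
    (hq : ∀ w ∈ q.support, w ∈ S) : JoinedIn (inducedDrawing E S) (E.point u) (E.point v) := by
  induction q with
  | nil => exact .refl (mem_inducedDrawing.2 (.inl ⟨_, hq _ (by simp), rfl⟩))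
  | @cons u v w huv q ih =>
    obtain ⟨γ, -, hγ⟩ := E.isPlaneArc u v huv
    have hends : ∀ x ∈ s(u, v), x ∈ S := by
      intro x hx
      rcases Sym2.mem_iff.1 hx with rfl | rfl <;> exact hq _ (by simp)
    have hedge : JoinedIn (inducedDrawing E S) (E.point u) (E.point v) :=
      ⟨γ, fun t ↦ mem_inducedDrawing.2 (.inr ⟨⟨s(u, v), huv⟩, hends, hγ ▸ Set.mem_range_self t⟩)⟩
    exact hedge.trans (ih fun x hx ↦ hq x (by simp [hx]))

theorem disjoint_inducedDrawing (E : G.PlaneEmbedding) {S T : Set V} (hST : Disjoint S T) :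
    Disjoint (inducedDrawing E S) (inducedDrawing E T) := by
  have hno : ∀ e : Sym2 V, (∀ w ∈ e, w ∈ S) → ∀ f : Sym2 V, (∀ w ∈ f, w ∈ T) →
      ∀ w ∈ e, w ∉ f := fun e he f hf w hwe hwf ↦ Set.disjoint_left.1 hST (he w hwe) (hf w hwf)
  simp only [Set.disjoint_left, mem_inducedDrawing]
  rintro _ (⟨w, hw, rfl⟩ | ⟨e, he, hae⟩) (⟨w', hw', haw⟩ | ⟨f, hf, haf⟩)
  · exact Set.disjoint_left.1 hST hw (E.point_injective haw ▸ hw')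
  · exact Set.disjoint_left.1 hST hw (hf w (E.mem_of_point_mem f w haf))
  · subst haw
    exact Set.disjoint_left.1 hST (he w' (E.mem_of_point_mem e w' hae)) hw'
  · have hef : e ≠ f := fun h ↦ hno e he f hf _ (Sym2.out_fst_mem _) (h ▸ Sym2.out_fst_mem _)
    obtain ⟨w, ⟨hwe, hwf⟩, -⟩ := E.inter_subset e f hef ⟨hae, haf⟩
    exact hno e he f hf w hwe hwf

/-- Walks through the five vertices inside the balls would draw `K₅`: by
`edist_le_or_edist_le_of_add_le`, walks belonging to disjoint pairs do not meet. -/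
theorem not_forall_exists_edist_le_iff_of_isPlanar (hG : G.IsPlanar) (l : ℕ) (x : Fin 5 → V) :
    ¬ ∀ i j, i ≠ j → ∃ z, ∀ h, G.edist z (x h) ≤ l ↔ h = i ∨ h = j := by
  intro hz
  obtain ⟨E⟩ := hG
  let φ : EuclideanSpace ℝ (Fin 2) ≃ₗᵢ[ℝ] ℂ := Complex.orthonormalBasisOneI.repr.symm
  let S : Fin 5 → Fin 5 → Set V := fun i j ↦ {w | ∃ z,
    (∀ h, G.edist z (x h) ≤ l ↔ h = i ∨ h = j) ∧
      (G.edist z w + G.edist w (x i) ≤ l ∨ G.edist z w + G.edist w (x j) ≤ l)}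
  have hjoin : ∀ i j, i ≠ j →
      JoinedIn (φ '' inducedDrawing E (S i j)) (φ (E.point (x i))) (φ (E.point (x j))) := by
    intro i j hij
    obtain ⟨z, hz⟩ := hz i j hij
    obtain ⟨q, hq⟩ := exists_walk_forall_edist_add_edist_le ((hz i).2 (.inl rfl))
      ((hz j).2 (.inr rfl))
    have hwalk : JoinedIn (inducedDrawing E (S i j)) (E.point (x i)) (E.point (x j)) :=
      joinedIn_inducedDrawing E q fun w hw ↦ ⟨z, hz, hq w hw⟩
    exact hwalk.map φ.continuous
  have hdisj : ∀ i j k m, [i, j, k, m].Nodup → Disjoint (S i j) (S k m) := by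
    intro i j k m hn
    refine Set.disjoint_left.2 ?_
    rintro w ⟨z, hz, hw⟩ ⟨z', hz', hw'⟩
    have hzk : ¬ G.edist z (x k) ≤ l := by rw [hz]; grind
    have hzm : ¬ G.edist z (x m) ≤ l := by rw [hz]; grind
    have hzi : ¬ G.edist z' (x i) ≤ l := by rw [hz']; grind
    have hzj : ¬ G.edist z' (x j) ≤ l := by rw [hz']; grind
    rcases hw with hw | hw <;> rcases hw' with hw' | hw' <;>
      rcases edist_le_or_edist_le_of_add_le hw hw' with h | h <;> contradiction
  obtain ⟨i, j, k, m, hn, a, ha, ha'⟩ := exists_disjoint_edges_meet hjoin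
  exact Set.disjoint_left.1
    ((Set.disjoint_image_iff φ.injective).2 (disjoint_inducedDrawing E (hdisj i j k m hn))) ha ha'

end Planar

/-! ### Ramsey's theorem and the minimax theorem -/

section Combinatorics

open Finset

theorem exists_isNClique_or_isNClique_compl {κ : Type*} (G : SimpleGraph κ) {s t : ℕ}
    {S : Finset κ} (hS : (s + t).choose s ≤ #S) :
    ∃ K ⊆ S, G.IsNClique (s + 1) K ∨ Gᶜ.IsNClique (t + 1) K := by
  classical
  induction s generalizing t S with
  | zero =>
    obtain ⟨x, hx⟩ := card_pos.1 (Nat.choose_pos (Nat.zero_le _) |>.trans_le hS)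
    exact ⟨{x}, by simpa using hx, .inl (SimpleGraph.isNClique_one.2 ⟨x, rfl⟩)⟩
  | succ s ihs =>
    induction t generalizing S with
    | zero =>
      obtain ⟨x, hx⟩ := card_pos.1 (Nat.choose_pos (Nat.le_add_right _ _) |>.trans_le hS)
      exact ⟨{x}, by simpa using hx, .inr (SimpleGraph.isNClique_one.2 ⟨x, rfl⟩)⟩
    | succ t iht =>
      obtain ⟨x, hx⟩ := card_pos.1 (Nat.choose_pos (Nat.le_add_right _ _) |>.trans_le hS)
      have hins : ∀ {H : SimpleGraph κ} {K : Finset κ} {n : ℕ}, K ⊆ S → (∀ y ∈ K, H.Adj x y) →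
          H.IsNClique n K → insert x K ⊆ S ∧ H.IsNClique (n + 1) (insert x K) :=
        fun hKS hadj hK ↦ ⟨insert_subset hx hKS, hK.insert hadj⟩
      let N := (S.erase x).filter (G.Adj x)
      let M := (S.erase x).filter fun y ↦ ¬ G.Adj x y
      have hN : ∀ y ∈ N, G.Adj x y := fun y hy ↦ (mem_filter.1 hy).2
      have hM : ∀ y ∈ M, Gᶜ.Adj x y := fun y hy ↦ by
        rw [mem_filter, mem_erase] at hy
        exact (G.compl_adj x y).2 ⟨hy.1.1.symm, hy.2⟩
      have hNS : N ⊆ S := (filter_subset _ _).trans (erase_subset _ _)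
      have hMS : M ⊆ S := (filter_subset _ _).trans (erase_subset _ _)
      have hpascal : (s + 1 + (t + 1)).choose (s + 1) =
          (s + (t + 1)).choose s + (s + 1 + t).choose (s + 1) := by
        rw [← add_assoc, Nat.choose_succ_succ, add_right_comm s 1 t, ← add_assoc]
      have hcard : #N + #M + 1 = #S := by
        rw [card_filter_add_card_filter_not, card_erase_add_one hx]
      rcases le_or_gt ((s + (t + 1)).choose s) #N with h | h
      · obtain ⟨K, hK, hclique | hclique⟩ := ihs h
        · obtain ⟨hsub, hins⟩ := hins (hK.trans hNS) (fun y hy ↦ hN y (hK hy)) hclique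
          exact ⟨_, hsub, .inl hins⟩
        · exact ⟨K, hK.trans hNS, .inr hclique⟩
      · obtain ⟨K, hK, hclique | hclique⟩ := iht (S := M) (by omega)
        · exact ⟨K, hK.trans hMS, .inl hclique⟩
        · obtain ⟨hsub, hins⟩ := hins (hK.trans hMS) (fun y hy ↦ hM y (hK hy)) hclique
          exact ⟨_, hsub, .inr hins⟩

section Minimax

variable {α : Type*} [Fintype α] {c : α → ℝ} {ε u : ℝ}

theorem nonneg_of_forall_sum_mul_lt (hlt : ∀ x : α → ℝ, (∀ a, x a < ε) → ∑ a, x a * c a < u)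
    (a : α) : 0 ≤ c a := by
  classical
  by_contra! ha
  let t := |u - (ε - 1) * ∑ b, c b| / (-c a)
  have ht0 : 0 ≤ t := div_nonneg (abs_nonneg _) (neg_pos.2 ha).le
  have ht : t * -c a = |u - (ε - 1) * ∑ b, c b| := div_mul_cancel₀ _ (neg_pos.2 ha).ne'
  have hx := hlt (fun b ↦ (ε - 1) - if b = a then t else 0) fun b ↦ by split_ifs <;> linarith
  have hsum : ∑ b, ((ε - 1) - if b = a then t else 0) * c b = (ε - 1) * ∑ b, c b - t * c a := by
    simp [sub_mul _ (ite _ _ _), mul_sum]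
  linarith [le_abs_self (u - (ε - 1) * ∑ b, c b)]

theorem exists_mem_stdSimplex_of_forall_sum_mul_lt {K : Set (α → ℝ)} (hne : K.Nonempty)
    (hlt : ∀ x : α → ℝ, (∀ a, x a < ε) → ∑ a, x a * c a < u)
    (hK : ∀ x ∈ K, u ≤ ∑ a, x a * c a) :
    ∃ p ∈ stdSimplex ℝ α, ∀ x ∈ K, ε ≤ ∑ a, p a * x a := by
  have hc := nonneg_of_forall_sum_mul_lt hlt
  have hC : 0 < ∑ a, c a := by
    refine (sum_nonneg fun a _ ↦ hc a).lt_of_ne fun h0 ↦ ?_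
    have hc0 : ∀ a, c a = 0 := by simpa [sum_eq_zero_iff_of_nonneg, hc] using h0.symm
    obtain ⟨x, hx⟩ := hne
    have h1 := hlt (fun _ ↦ ε - 1) fun _ ↦ sub_one_lt ε
    have h2 := hK x hx
    simp only [hc0, mul_zero, sum_const_zero] at h1 h2
    exact h2.not_gt h1
  have hu : ε * ∑ a, c a ≤ u := by
    by_contra! h
    have := hlt (fun _ ↦ u / ∑ a, c a) fun _ ↦ (div_lt_iff₀ hC).2 h
    rw [← mul_sum, div_mul_cancel₀ _ hC.ne'] at this
    exact this.false
  refine ⟨fun a ↦ c a / ∑ b, c b, ⟨fun a ↦ div_nonneg (hc a) hC.le, ?_⟩, fun x hx ↦ ?_⟩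
  · rw [← sum_div, div_self hC.ne']
  · calc ε ≤ (∑ a, x a * c a) / ∑ b, c b := (le_div_iff₀ hC).2 (hu.trans (hK x hx))
      _ = ∑ a, c a / (∑ b, c b) * x a := by
        rw [sum_div]
        exact sum_congr rfl fun a _ ↦ by ring

/-- Separate `K` from the open orthant below `ε`. -/
theorem exists_forall_lt_or_exists_forall_le_sum_mul {K : Set (α → ℝ)} (hK : Convex ℝ K)
    (hne : K.Nonempty) (ε : ℝ) :
    (∃ x ∈ K, ∀ a, x a < ε) ∨ ∃ p ∈ stdSimplex ℝ α, ∀ x ∈ K, ε ≤ ∑ a, p a * x a := by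
  classical
  by_cases hd : Disjoint (Set.univ.pi fun _ : α ↦ Set.Iio ε) K
  · obtain ⟨f, u, hlt, hle⟩ := geometric_hahn_banach_open
      (convex_pi fun _ _ ↦ convex_Iio ε) (isOpen_set_pi Set.finite_univ fun _ _ ↦ isOpen_Iio) hK hd
    have hf : ∀ x, f x = ∑ a, x a * f (Pi.single a 1) := fun x ↦ by
      conv_lhs => rw [pi_eq_sum_univ' x, map_sum]
      exact sum_congr rfl fun a _ ↦ by rw [map_smul, smul_eq_mul]
    exact .inr (exists_mem_stdSimplex_of_forall_sum_mul_lt hne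
      (fun x hx ↦ hf x ▸ hlt x fun a _ ↦ hx a) fun x hx ↦ hf x ▸ hle x hx)
  · obtain ⟨x, hx, hxK⟩ := Set.not_disjoint_iff.1 hd
    exact .inl ⟨x, hxK, fun a ↦ hx a trivial⟩

theorem exists_strategy_or_exists_strategy {ι : Type*} [Fintype ι] [Nonempty ι] (M : ι → α → ℝ)
    (ε : ℝ) :
    (∃ q ∈ stdSimplex ℝ ι, ∀ a, ∑ i, q i * M i a < ε) ∨
      ∃ p ∈ stdSimplex ℝ α, ∀ i, ε ≤ ∑ a, p a * M i a := by
  classical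
  have hL : ∀ q a, Fintype.linearCombination ℝ M q a = ∑ i, q i * M i a := fun q a ↦ by
    simp [Fintype.linearCombination_apply]
  obtain ⟨_, ⟨q, hq, rfl⟩, hlt⟩ | ⟨p, hp, hle⟩ := exists_forall_lt_or_exists_forall_le_sum_mul
    ((convex_stdSimplex ℝ ι).linear_image (Fintype.linearCombination ℝ M))
    (.image _ ⟨_, single_mem_stdSimplex ℝ (Classical.arbitrary ι)⟩) ε
  · exact .inl ⟨q, hq, fun a ↦ hL q a ▸ hlt a⟩
  · refine .inr ⟨p, hp, fun i ↦ ?_⟩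
    simpa [hL, Pi.single_apply] using hle _ ⟨_, single_mem_stdSimplex ℝ i, rfl⟩

end Minimax

/-! ### Independent samples -/

section Sampling

variable {ι κ κ' τ α : Type*} [Fintype κ] [DecidableEq κ] [Fintype κ'] [DecidableEq κ'] [Fintype α]
  {p : α → ℝ} {Q Q' : (κ → α) → Prop} {c : ℝ}

open Classical in
/-- The probability that a family of independent samples `z k`, one for every `k : κ`, of the
distribution `p` has the property `Q`. -/
noncomputable def iidProb (p : α → ℝ) (Q : (κ → α) → Prop) : ℝ :=
  ∑ z with Q z, ∏ k, p (z k)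

theorem iidProb_eq_sum_mul_ite [DecidablePred Q] :
    iidProb p Q = ∑ z, (∏ k, p (z k)) * if Q z then 1 else 0 := by
  simp only [iidProb, mul_ite, mul_one, mul_zero, sum_filter]
  congr!

theorem sum_prod_eq_one (hp : p ∈ stdSimplex ℝ α) : ∑ z : κ → α, ∏ k, p (z k) = 1 := by
  rw [← Fintype.prod_sum fun _ ↦ p, hp.2, prod_const_one]

theorem iidProb_not (hp : p ∈ stdSimplex ℝ α) : iidProb p (fun z ↦ ¬ Q z) = 1 - iidProb p Q := by
  classical
  rw [eq_sub_iff_add_eq', ← sum_prod_eq_one (κ := κ) hp, iidProb, iidProb]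
  convert sum_filter_add_sum_filter_not univ Q _

theorem iidProb_mono (hp : p ∈ stdSimplex ℝ α) (h : ∀ z, Q z → Q' z) :
    iidProb p Q ≤ iidProb p Q' := by
  classical
  exact sum_le_sum_of_subset_of_nonneg (monotone_filter_right _ fun z _ ↦ h z)
    fun _ _ _ ↦ prod_nonneg fun _ _ ↦ hp.1 _

theorem iidProb_comp_equiv (e : κ ≃ κ') (Q : (κ → α) → Prop) :
    iidProb p (fun z : κ' → α ↦ Q (z ∘ e)) = iidProb p Q := by
  classical
  simp only [iidProb_eq_sum_mul_ite]
  refine Fintype.sum_equiv (e.arrowCongr (.refl α)).symm _ _ fun z ↦ ?_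
  congr 1
  exact (e.prod_comp fun k ↦ p (z k)).symm

theorem iidProb_sum (Q : (κ ⊕ κ' → α) → Prop) :
    iidProb p Q = ∑ x : κ → α, (∏ k, p (x k)) * iidProb p fun y ↦ Q (Sum.elim x y) := by
  classical
  simp only [iidProb_eq_sum_mul_ite]
  rw [← (Equiv.sumArrowEquivProdArrow κ κ' α).symm.sum_comp, Fintype.sum_prod_type]
  refine sum_congr rfl fun x _ ↦ ?_
  rw [mul_sum]
  refine sum_congr rfl fun y _ ↦ ?_
  rw [Fintype.prod_sum_type, mul_assoc]
  rfl

theorem le_iidProb_of_forall_sumElim (hp : p ∈ stdSimplex ℝ α) {Q : (κ ⊕ κ' → α) → Prop}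
    (hQ : ∀ x, c ≤ iidProb p fun y ↦ Q (Sum.elim x y)) : c ≤ iidProb p Q :=
  calc c = ∑ x : κ → α, (∏ k, p (x k)) * c := by rw [← sum_mul, sum_prod_eq_one hp, one_mul]
    _ ≤ _ := sum_le_sum fun x _ ↦
        mul_le_mul_of_nonneg_left (hQ x) (prod_nonneg fun _ _ ↦ hp.1 _)
    _ = iidProb p Q := (iidProb_sum Q).symm

theorem iidProb_le_of_forall_update [DecidablePred Q] (hp : p ∈ stdSimplex ℝ α) (h : κ)
    (hQ : ∀ z, ∑ a with Q (Function.update z h a), p a ≤ c) : iidProb p Q ≤ c := by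
  obtain ⟨a₀⟩ : Nonempty α := by
    by_contra! hα
    simpa using hp.2
  let e := (Equiv.funSplitAt h α).symm
  have he : ∀ a b g, e (a, g) = Function.update (e (b, g)) h a := fun a b g ↦ by
    ext k
    by_cases hk : k = h <;> simp [e, hk]
  have hprod : ∀ a g, ∏ k, p (e (a, g) k) = p a * ∏ k, p (g k) := fun a g ↦ by
    rw [Fintype.prod_eq_mul_prod_subtype_ne _ h]
    congr 1
    · simp [e]
    · exact prod_congr rfl fun k _ ↦ by simp [e, k.2]
  calc iidProb p Q = ∑ g, (∏ k, p (g k)) * ∑ a with Q (e (a, g)), p a := by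
        rw [iidProb_eq_sum_mul_ite, ← e.sum_comp, Fintype.sum_prod_type, sum_comm]
        refine sum_congr rfl fun g _ ↦ ?_
        rw [sum_filter, mul_sum]
        exact sum_congr rfl fun a _ ↦ by split_ifs <;> simp [hprod, mul_comm]
    _ ≤ ∑ g : { k // k ≠ h } → α, (∏ k, p (g k)) * c := by
        gcongr with g
        · exact prod_nonneg fun _ _ ↦ hp.1 _
        · simpa only [← he] using hQ (e (a₀, g))
    _ = c := by rw [← sum_mul, sum_prod_eq_one hp, one_mul]

theorem exists_sum_iidProb_le_card (hp : p ∈ stdSimplex ℝ α) (T : Finset τ)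
    (Q : τ → (κ → α) → Prop) [∀ x, DecidablePred (Q x)] :
    ∃ z, ∑ x ∈ T, iidProb p (Q x) ≤ #{x ∈ T | Q x z} := by
  by_contra! hlt
  have hsum : ∑ x ∈ T, iidProb p (Q x) = ∑ z, (∏ k, p (z k)) * (#{x ∈ T | Q x z} : ℝ) := by
    simp only [iidProb_eq_sum_mul_ite, ← sum_boole, mul_sum]
    exact sum_comm
  have hprod : ∀ z : κ → α, 0 ≤ ∏ k, p (z k) := fun z ↦ prod_nonneg fun _ _ ↦ hp.1 _
  obtain ⟨z, hz⟩ : ∃ z : κ → α, 0 < ∏ k, p (z k) := by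
    by_contra! h
    have := sum_prod_eq_one (κ := κ) hp
    exact zero_ne_one ((sum_eq_zero fun z _ ↦ (h z).antisymm (hprod z)).symm.trans this)
  refine (hsum.trans_lt ?_).ne rfl
  calc ∑ z, (∏ k, p (z k)) * (#{x ∈ T | Q x z} : ℝ)
      < ∑ z : κ → α, (∏ k, p (z k)) * ∑ x ∈ T, iidProb p (Q x) :=
        sum_lt_sum (fun z _ ↦ mul_le_mul_of_nonneg_left (hlt z).le (hprod z))
          ⟨z, mem_univ z, mul_lt_mul_of_pos_left (hlt z) hz⟩
    _ = ∑ x ∈ T, iidProb p (Q x) := by rw [← sum_mul, sum_prod_eq_one hp, one_mul]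

theorem exists_card_le_sum_iidProb (hp : p ∈ stdSimplex ℝ α) (T : Finset τ)
    (Q : τ → (κ → α) → Prop) [∀ x, DecidablePred (Q x)] :
    ∃ z, #{x ∈ T | Q x z} ≤ ∑ x ∈ T, iidProb p (Q x) := by
  obtain ⟨z, hz⟩ := exists_sum_iidProb_le_card hp T fun x z ↦ ¬ Q x z
  have hcard : (#{x ∈ T | Q x z} : ℝ) + #{x ∈ T | ¬ Q x z} = #T := by
    exact_mod_cast card_filter_add_card_filter_not _
  simp only [iidProb_not hp, sum_sub_distrib, sum_const, nsmul_eq_mul, mul_one] at hz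
  exact ⟨z, by linarith⟩

end Sampling

/-! ### Sets with private intersections -/

section PrivateIntersections

variable {ι κ α : Type*} {B : ι → Finset α}

/-- Any two of the sets `B i` with `i ∈ K` have a common point that lies in no third one. The
maximum of `#K` is the parameter of set systems in the theorem of Ding, Seymour and Winkler. -/
def PrivatelyIntersecting (B : ι → Finset α) (K : Finset ι) : Prop :=
  ∀ i ∈ K, ∀ j ∈ K, i ≠ j → ∃ a, ∀ h ∈ K, a ∈ B h ↔ h = i ∨ h = j

theorem PrivatelyIntersecting.injOn {K : Finset ι} (hK : PrivatelyIntersecting B K)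
    (hcard : 3 ≤ #K) : Set.InjOn B K := by
  classical
  intro i hi j hj hij
  by_contra hne
  obtain ⟨h, hh, hhij⟩ := exists_mem_notMem_of_card_lt_card (s := {i, j}) (t := K)
    (card_le_two.trans_lt hcard)
  simp only [mem_insert, mem_singleton, not_or] at hhij
  obtain ⟨a, ha⟩ := hK i hi h hh (Ne.symm hhij.1)
  rcases (ha j hj).1 (hij ▸ (ha i hi).2 (.inl rfl)) with rfl | rfl
  exacts [hne rfl, hhij.2 rfl]

theorem PrivatelyIntersecting.image [DecidableEq ι] {f : κ → ι} {K : Finset κ}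
    (hK : PrivatelyIntersecting (B ∘ f) K) (hf : Set.InjOn f K) :
    PrivatelyIntersecting B (K.image f) := by
  simp only [PrivatelyIntersecting, forall_mem_image]
  intro i hi j hj hij
  obtain ⟨a, ha⟩ := hK i hi j hj (ne_of_apply_ne f hij)
  refine ⟨a, fun h hh ↦ (ha h hh).trans ?_⟩
  rw [hf.eq_iff hh hi, hf.eq_iff hh hj]

theorem PrivatelyIntersecting.exists_card_eq {f : κ → ι} {K : Finset κ}
    (hK : PrivatelyIntersecting (B ∘ f) K) (hcard : 3 ≤ #K) :
    ∃ L, PrivatelyIntersecting B L ∧ #L = #K := by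
  classical
  have hf : Set.InjOn f K := (hK.injOn hcard).of_comp
  exact ⟨_, hK.image hf, card_image_of_injOn hf⟩

/-- Sample `2 * R` times: about `4 * R ^ 3` triples are to be avoided, so on average at most `R` of
them occur, and deleting the last element of each leaves `R` samples. -/
theorem exists_sample_avoiding [Fintype ι] {q : ι → ℝ} (hq : q ∈ stdSimplex ℝ ι)
    {P : ι → ι → ι → Prop} [∀ i j, DecidablePred (P i j)] {R : ℕ} (hR : 0 < R)
    (hP : ∀ i j, ∑ h with P i j h, q h ≤ 1 / (4 * (R : ℝ) ^ 2)) :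
    ∃ (f : Fin (2 * R) → ι) (S : Finset (Fin (2 * R))), R ≤ #S ∧
      ∀ i j, ∀ h ∈ S, i < j → h ≠ i → h ≠ j → ¬ P (f i) (f j) (f h) := by
  classical
  let κ := Fin (2 * R)
  let T : Finset ((κ × κ) × κ) := {x | x.1.1 < x.1.2 ∧ x.2 ≠ x.1.1 ∧ x.2 ≠ x.1.2}
  have hT : #T ≤ 4 * R ^ 3 := by
    have hpairs : 2 * (2 * R).choose 2 ≤ (2 * R) ^ 2 := by
      rw [Nat.choose_two_right]
      exact (Nat.mul_div_le _ _).trans (by rw [sq]; gcongr; omega)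
    calc #T ≤ #(({x | x.1 < x.2} : Finset (κ × κ)) ×ˢ (univ : Finset κ)) :=
          card_le_card fun x hx ↦ by simpa using (mem_filter.1 hx).2.1
      _ = (2 * R).choose 2 * (2 * R) := by
          rw [card_product, Fintype.card_product_filter_lt, card_univ, Fintype.card_fin]
      _ ≤ 4 * R ^ 3 := by nlinarith
  obtain ⟨f, hf⟩ := exists_card_le_sum_iidProb hq T
    fun x (f : κ → ι) ↦ P (f x.1.1) (f x.1.2) (f x.2)
  set bad := {x ∈ T | P (f x.1.1) (f x.1.2) (f x.2)}
  have hbad : #bad ≤ R := by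
    have hR0 : (R : ℝ) ≠ 0 := by positivity
    rify
    calc (#bad : ℝ) ≤ ∑ x ∈ T, 1 / (4 * (R : ℝ) ^ 2) := by
          refine hf.trans (sum_le_sum fun x hx ↦ iidProb_le_of_forall_update hq x.2 fun z ↦ ?_)
          obtain ⟨-, -, h₁, h₂⟩ := mem_filter.1 hx
          simpa only [Function.update_self, Function.update_of_ne h₁.symm,
            Function.update_of_ne h₂.symm] using hP _ _
      _ ≤ 4 * (R : ℝ) ^ 3 * (1 / (4 * (R : ℝ) ^ 2)) := by
          rw [sum_const, nsmul_eq_mul]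
          gcongr
          exact_mod_cast hT
      _ = R := by field_simp
  refine ⟨f, univ \ bad.image Prod.snd, ?_, fun i j h hh hij hhi hhj hPf ↦ ?_⟩
  · have := le_card_sdiff (bad.image Prod.snd) (univ : Finset κ)
    have := card_image_le (s := bad) (f := Prod.snd)
    simp only [card_univ, Fintype.card_fin, κ] at *
    omega
  · exact (mem_sdiff.1 hh).2 (mem_image.2
      ⟨((i, j), h), mem_filter.2 ⟨mem_filter.2 ⟨mem_univ _, hij, hhi, hhj⟩, hPf⟩, rfl⟩)

theorem exists_privatelyIntersecting_or_pairwiseDisjoint [DecidableEq α] {S : Finset ι} {d ν : ℕ}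
    (hcard : (d + ν).choose d ≤ #S)
    (hS : ∀ i ∈ S, ∀ j ∈ S, i ≠ j → (B i ∩ B j).Nonempty →
      ∃ a ∈ B i ∩ B j, ∀ h ∈ S, h ≠ i → h ≠ j → a ∉ B h) :
    (∃ K, PrivatelyIntersecting B K ∧ #K = d + 1) ∨
      ∃ K : Finset ι, (K : Set ι).PairwiseDisjoint B ∧ #K = ν + 1 := by
  let G : SimpleGraph ι := .fromRel fun i j ↦ (B i ∩ B j).Nonempty
  have hG : ∀ i j, G.Adj i j ↔ i ≠ j ∧ (B i ∩ B j).Nonempty := fun i j ↦ by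
    rw [SimpleGraph.fromRel_adj, inter_comm (B j), or_self]
  obtain ⟨K, hKS, hK | hK⟩ := exists_isNClique_or_isNClique_compl G hcard
  · refine .inl ⟨K, fun i hi j hj hij ↦ ?_, hK.card_eq⟩
    obtain ⟨a, ha, hsep⟩ :=
      hS i (hKS hi) j (hKS hj) hij ((hG i j).1 (hK.isClique hi hj hij)).2
    rw [mem_inter] at ha
    refine ⟨a, fun h hh ↦ ⟨fun hah ↦ ?_, ?_⟩⟩
    · by_contra! hne
      exact hsep h (hKS hh) hne.1 hne.2 hah
    · rintro (rfl | rfl)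
      exacts [ha.1, ha.2]
  · refine .inr ⟨K, fun i hi j hj hij ↦ disjoint_iff_inter_eq_empty.2 ?_, hK.card_eq⟩
    rw [← not_nonempty_iff_eq_empty]
    exact fun h ↦ ((G.compl_adj i j).1 (hK.isClique hi hj hij)).2 ((hG i j).2 ⟨hij, h⟩)

theorem exists_privatelyIntersecting_of_weights [Fintype ι] [DecidableEq α] {d ν : ℕ} (hd : 2 ≤ d)
    (hB : ∀ i, (B i).Nonempty)
    (hν : ∀ S : Finset ι, (S : Set ι).PairwiseDisjoint B → #S ≤ ν) {q : ι → ℝ}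
    (hq : q ∈ stdSimplex ℝ ι)
    (hlt : ∀ a, ∑ i with a ∈ B i, q i ≤ 1 / (4 * ((d + ν).choose d : ℝ) ^ 2)) :
    ∃ K, PrivatelyIntersecting B K ∧ #K = d + 1 := by
  classical
  let P : ι → ι → ι → Prop := fun i j h ↦ ∃ hij : (B i ∩ B j).Nonempty, hij.choose ∈ B h
  have hP : ∀ i j, ∑ h with P i j h, q h ≤ 1 / (4 * ((d + ν).choose d : ℝ) ^ 2) := fun i j ↦ by
    by_cases hij : (B i ∩ B j).Nonempty
    · simpa only [P, exists_prop_of_true hij] using hlt _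
    · simp only [P, exists_prop_of_false hij, filter_false, sum_empty]
      positivity
  obtain ⟨f, S, hS, hf⟩ := exists_sample_avoiding hq (Nat.choose_pos (Nat.le_add_right d ν)) hP
  have hsep : ∀ i ∈ S, ∀ j ∈ S, i ≠ j → (B (f i) ∩ B (f j)).Nonempty →
      ∃ a ∈ B (f i) ∩ B (f j), ∀ h ∈ S, h ≠ i → h ≠ j → a ∉ B (f h) := by
    intro i hi j hj hij hne
    wlog h : i < j generalizing i j
    · simpa only [inter_comm (B (f i)), and_comm, imp.swap] using
        this j hj i hi hij.symm (by rwa [inter_comm]) (hij.lt_or_gt.resolve_left h)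
    · exact ⟨_, hne.choose_spec, fun h' hh' hi' hj' ha ↦ hf i j h' hh' h hi' hj' ⟨hne, ha⟩⟩
  rcases exists_privatelyIntersecting_or_pairwiseDisjoint (B := B ∘ f) hS hsep with
    ⟨K, hK, hcard⟩ | ⟨K, hK, hcard⟩
  · rw [← hcard]
    exact hK.exists_card_eq (by omega)
  · have hinj : Set.InjOn f K := fun i hi j hj hij ↦ by
      by_contra hne
      have : Disjoint (B (f i)) (B (f j)) := hK hi hj hne
      rw [hij, disjoint_self_iff_empty] at this
      exact (hB _).ne_empty this
    have := hν (K.image f) (by rw [coe_image, hinj.pairwiseDisjoint_image]; exact hK)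
    rw [card_image_of_injOn hinj] at this
    omega

end PrivateIntersections

/-! ### ε-nets -/

section EpsilonNet

variable {κ α β : Type*}

theorem sum_Iic_choose_le_pow (n D : ℕ) : ∑ k ∈ Iic D, n.choose k ≤ (n + 1) ^ D := by
  rw [add_pow, ← Nat.range_succ_eq_Iic]
  refine sum_le_sum fun k hk ↦ ?_
  have hD : 0 < D.choose k := Nat.choose_pos (Nat.lt_succ_iff.1 (mem_range.1 hk))
  calc n.choose k ≤ n ^ k := Nat.choose_le_pow n k
    _ ≤ n ^ k * 1 ^ (D - k) * D.choose k := by simpa using Nat.le_mul_of_pos_right _ hD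

theorem card_le_pow_vcDim [Fintype β] [DecidableEq β] (𝒜 : Finset (Finset β)) :
    #𝒜 ≤ (Fintype.card β + 1) ^ 𝒜.vcDim :=
  (card_le_card_shatterer 𝒜).trans (card_shatterer_le_sum_vcDim.trans (sum_Iic_choose_le_pow _ _))

theorem vcDim_image_filter_mem_le [Fintype β] [DecidableEq β] [DecidableEq α]
    (𝒜 : Finset (Finset α)) (z : β → α) :
    (𝒜.image fun A ↦ ({b | z b ∈ A} : Finset β)).vcDim ≤ 𝒜.vcDim := by
  refine Finset.sup_le fun S hS ↦ ?_
  have hS' : ∀ T ⊆ S, ∃ A ∈ 𝒜, ∀ b ∈ S, z b ∈ A ↔ b ∈ T := fun T hT ↦ by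
    obtain ⟨_, hu, rfl⟩ := mem_shatterer.1 hS hT
    obtain ⟨A, hA, rfl⟩ := mem_image.1 hu
    exact ⟨A, hA, fun b hb ↦ by simp [hb]⟩
  have hinj : Set.InjOn z S := fun b hb b' hb' hbb' ↦ by
    obtain ⟨A, -, hA⟩ := hS' {b} (singleton_subset_iff.2 hb)
    exact (mem_singleton.1 ((hA b' hb').1 (hbb' ▸ (hA b hb).2 (mem_singleton_self b)))).symm
  rw [← card_image_of_injOn hinj]
  refine Shatters.card_le_vcDim fun T hT ↦ ?_
  obtain ⟨A, hA, h⟩ := hS' {b ∈ S | z b ∈ T} (filter_subset _ _)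
  refine ⟨A, hA, ?_⟩
  ext a
  constructor
  · intro ha
    obtain ⟨hS, haA⟩ := mem_inter.1 ha
    obtain ⟨b, hb, rfl⟩ := mem_image.1 hS
    exact (mem_filter.1 ((h b hb).1 haA)).2
  · intro ha
    obtain ⟨b, hb, rfl⟩ := mem_image.1 (hT ha)
    exact mem_inter.2 ⟨hT ha, (h b hb).2 (mem_filter.2 ⟨hb, ha⟩)⟩

/-- The value `σ t` is forced as soon as `T` contains one of `(t, false)` and `(t, true)`. -/
theorem card_swaps_mul_two_pow_le [Fintype κ] [DecidableEq κ] (T : Finset (κ × Bool)) (k : ℕ) :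
    #{σ : κ → Bool | (∀ t, (t, σ t) ∉ T) ∧ k ≤ #{t | (t, !σ t) ∈ T}} * 2 ^ k ≤
      2 ^ Fintype.card κ := by
  set F : Finset (κ → Bool) := {σ | (∀ t, (t, σ t) ∉ T) ∧ k ≤ #{t | (t, !σ t) ∈ T}}
  obtain hF | ⟨σ₀, hσ₀⟩ := F.eq_empty_or_nonempty
  · simp [hF]
  obtain ⟨-, -, hk⟩ := mem_filter.1 hσ₀
  set P : Finset κ := {t | (t, !σ₀ t) ∈ T}
  have hF : F ⊆ Fintype.piFinset fun t ↦ if t ∈ P then {σ₀ t} else univ := by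
    refine fun σ hσ ↦ Fintype.mem_piFinset.2 fun t ↦ ?_
    split_ifs with ht
    · rw [mem_singleton]
      by_contra hne
      exact (mem_filter.1 hσ).2.1 t (Bool.eq_not.2 hne ▸ (mem_filter.1 ht).2)
    · exact mem_univ _
  have hprod : ∏ t, #(if t ∈ P then {σ₀ t} else (univ : Finset Bool)) = 2 ^ #Pᶜ := by
    simp [apply_ite card, prod_ite, filter_not, ← compl_eq_univ_sdiff]
  calc #F * 2 ^ k ≤ 2 ^ #Pᶜ * 2 ^ #P := by
        rw [← hprod, ← Fintype.card_piFinset]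
        gcongr
        exact one_le_two
    _ = 2 ^ Fintype.card κ := by rw [← pow_add, card_compl_add_card]

/-- Markov's inequality for `2⁻¹ ^ #{t | y t ∈ A}`. -/
theorem iidProb_card_lt_le [Fintype κ] [DecidableEq κ] [Fintype α] [DecidableEq α] {p : α → ℝ}
    (hp : p ∈ stdSimplex ℝ α) (A : Finset α) (k : ℕ) :
    iidProb p (fun y : κ → α ↦ #{t | y t ∈ A} < k) ≤
      2 ^ k / 2 * Real.exp (-(∑ a ∈ A, p a) * Fintype.card κ / 2) := by
  let c : α → ℝ := fun a ↦ if a ∈ A then 1 / 2 else 1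
  have hc : ∀ a, 0 ≤ c a := fun a ↦ by simp only [c]; split_ifs <;> norm_num
  have hprod : ∀ y : κ → α, ∏ t, c (y t) = (1 / 2) ^ #{t | y t ∈ A} := fun y ↦ by
    simp only [c, prod_ite, prod_const, one_pow, mul_one]
  have hmarkov : ∀ y : κ → α, (if #{t | y t ∈ A} < k then (1 : ℝ) else 0) ≤
      2 ^ k / 2 * ∏ t, c (y t) := fun y ↦ by
    split_ifs with h
    · obtain ⟨j, rfl⟩ := Nat.exists_eq_add_of_lt h
      rw [hprod, one_div, inv_pow, pow_succ, pow_add]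
      field_simp
      exact one_le_pow₀ one_le_two
    · exact mul_nonneg (by positivity) (prod_nonneg fun t _ ↦ hc _)
  have hsum : ∑ a, p a * c a = 1 - (∑ a ∈ A, p a) / 2 := by
    rw [← hp.2, eq_sub_iff_add_eq, sum_div, ← univ_inter A, ← sum_ite_mem, ← sum_add_distrib]
    exact sum_congr rfl fun a _ ↦ by simp only [c]; split_ifs <;> ring
  have hexp : ∑ a, p a * c a ≤ Real.exp (-(∑ a ∈ A, p a) / 2) := by
    linarith [Real.add_one_le_exp (-(∑ a ∈ A, p a) / 2)]
  calc iidProb p (fun y : κ → α ↦ #{t | y t ∈ A} < k)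
      ≤ ∑ y : κ → α, (∏ t, p (y t)) * (2 ^ k / 2 * ∏ t, c (y t)) := by
        rw [iidProb_eq_sum_mul_ite]
        exact sum_le_sum fun y _ ↦
          mul_le_mul_of_nonneg_left (hmarkov y) (prod_nonneg fun t _ ↦ hp.1 _)
    _ = 2 ^ k / 2 * (∑ a, p a * c a) ^ Fintype.card κ := by
        simp only [← card_univ (α := κ), ← prod_const, Fintype.prod_sum, prod_mul_distrib, mul_sum,
          mul_left_comm]
    _ ≤ 2 ^ k / 2 * Real.exp (-(∑ a ∈ A, p a) / 2) ^ Fintype.card κ := by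
        have : 0 ≤ ∑ a, p a * c a := sum_nonneg fun a _ ↦ mul_nonneg (hp.1 a) (hc a)
        gcongr
    _ = _ := by rw [← Real.exp_nat_mul]; congr 2; ring

section Symmetrization

variable [Fintype κ] [DecidableEq κ] [DecidableEq α] {𝒜 : Finset (Finset α)} {k : ℕ}

/-- Some member of `𝒜` is missed by the first half of the double sample `z` and hit at least `k`
times by the second half. -/
def MissedByHalf (𝒜 : Finset (Finset α)) (k : ℕ) (z : κ × Bool → α) : Prop :=
  ∃ A ∈ 𝒜, (∀ t, z (t, false) ∉ A) ∧ k ≤ #{t | z (t, true) ∈ A}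

theorem half_le_iidProb_missedByHalf [Fintype α] {p : α → ℝ} (hp : p ∈ stdSimplex ℝ α) {ε : ℝ}
    (hε : ∀ A ∈ 𝒜, ε ≤ ∑ a ∈ A, p a) (hmiss : ∀ x : κ → α, ∃ A ∈ 𝒜, ∀ t, x t ∉ A)
    (hk : (2 : ℝ) ^ k ≤ Real.exp (ε * Fintype.card κ / 2)) :
    1 / 2 ≤ iidProb p (MissedByHalf (κ := κ) 𝒜 k) := by
  rw [← iidProb_comp_equiv ((Equiv.prodComm κ Bool).trans (Equiv.boolProdEquivSum κ))]
  refine le_iidProb_of_forall_sumElim hp fun x ↦ ?_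
  obtain ⟨A, hA, hx⟩ := hmiss x
  have htail : iidProb p (fun y : κ → α ↦ #{t | y t ∈ A} < k) ≤ 1 / 2 :=
    calc _ ≤ 2 ^ k / 2 * Real.exp (-(∑ a ∈ A, p a) * Fintype.card κ / 2) :=
          iidProb_card_lt_le hp A k
      _ ≤ Real.exp (ε * Fintype.card κ / 2) / 2 * Real.exp (-ε * Fintype.card κ / 2) := by
          gcongr
          exact hε A hA
      _ = 1 / 2 := by
          rw [div_mul_eq_mul_div, ← Real.exp_add, ← add_div, ← add_mul, add_neg_cancel, zero_mul,
            zero_div, Real.exp_zero]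
  calc 1 / 2 ≤ iidProb p (fun y : κ → α ↦ ¬ #{t | y t ∈ A} < k) := by
        rw [iidProb_not hp]
        linarith
    _ ≤ _ := iidProb_mono hp fun y hy ↦ ⟨A, hA, hx, not_lt.1 hy⟩

/-- The permutation of a double sample that exchanges the two elements of the pairs selected by
`σ`. -/
def swapHalves (σ : κ → Bool) : Equiv.Perm (κ × Bool) :=
  .prodShear (.refl κ) fun t ↦ if σ t then Equiv.boolNot else .refl Bool

theorem card_missedByHalf_mul_two_pow_le [∀ z : κ × Bool → α, Decidable (MissedByHalf 𝒜 k z)]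
    (z : κ × Bool → α) :
    #{σ | MissedByHalf 𝒜 k (z ∘ swapHalves σ)} * 2 ^ k ≤
      (2 * Fintype.card κ + 1) ^ 𝒜.vcDim * 2 ^ Fintype.card κ := by
  let trace := 𝒜.image fun A ↦ ({x | z x ∈ A} : Finset (κ × Bool))
  let F : Finset (κ × Bool) → Finset (κ → Bool) := fun T ↦
    {σ | (∀ t, (t, σ t) ∉ T) ∧ k ≤ #{t | (t, !σ t) ∈ T}}
  have hsub : ({σ | MissedByHalf 𝒜 k (z ∘ swapHalves σ)} : Finset _) ⊆ trace.biUnion F := by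
    intro σ hσ
    obtain ⟨A, hA, hmiss, hhit⟩ := (mem_filter.1 hσ).2
    refine mem_biUnion.2 ⟨_, mem_image_of_mem _ hA, mem_filter.2 ⟨mem_univ _, ?_⟩⟩
    have hswap : ∀ t b, swapHalves σ (t, b) = (t, xor (σ t) b) := fun t b ↦ by
      cases h : σ t <;> simp [swapHalves, h]
    simpa [hswap] using And.intro hmiss hhit
  calc #{σ | MissedByHalf 𝒜 k (z ∘ swapHalves σ)} * 2 ^ k ≤ (∑ T ∈ trace, #(F T)) * 2 ^ k :=
        Nat.mul_le_mul_right _ ((card_le_card hsub).trans card_biUnion_le)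
    _ ≤ #trace * 2 ^ Fintype.card κ := by
        rw [sum_mul, ← smul_eq_mul (#trace), ← sum_const]
        exact sum_le_sum fun T _ ↦ card_swaps_mul_two_pow_le T k
    _ ≤ _ := by
        gcongr
        refine (card_le_pow_vcDim trace).trans ?_
        rw [Fintype.card_prod, Fintype.card_bool, mul_comm 2]
        exact Nat.pow_le_pow_right (Nat.succ_pos _) (vcDim_image_filter_mem_le 𝒜 z)

end Symmetrization

/-- The **ε-net theorem** of Haussler and Welzl. If all samples of size `m` miss a set, then so does
with probability at least `1 / 2` the first half of a double sample, whose second half hits it `k`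
times; but for a random exchange of the two halves this is unlikely. -/
theorem exists_card_le_forall_inter_nonempty [Fintype α] [DecidableEq α] {𝒜 : Finset (Finset α)}
    {p : α → ℝ} (hp : p ∈ stdSimplex ℝ α) {ε : ℝ} (hε : ∀ A ∈ 𝒜, ε ≤ ∑ a ∈ A, p a) {m : ℕ}
    (hm : 4 * (2 * m + 1 : ℝ) ^ 𝒜.vcDim ≤ Real.exp (ε * m / 2)) :
    ∃ X : Finset α, #X ≤ m ∧ ∀ A ∈ 𝒜, (A ∩ X).Nonempty := by
  classical
  obtain ⟨k, hk, hk'⟩ : ∃ k : ℕ, (2 : ℝ) ^ k ≤ Real.exp (ε * m / 2) ∧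
      Real.exp (ε * m / 2) < 2 ^ (k + 1) := by
    refine exists_nat_pow_near (le_trans ?_ hm) one_lt_two
    have : (1 : ℝ) ≤ (2 * m + 1) ^ 𝒜.vcDim := one_le_pow₀ (by linarith [m.cast_nonneg (α := ℝ)])
    linarith
  by_contra! hX
  have hmiss : ∀ x : Fin m → α, ∃ A ∈ 𝒜, ∀ t, x t ∉ A := fun x ↦ by
    obtain ⟨A, hA, h⟩ := hX (univ.image x) (by simpa using card_image_le (s := univ) (f := x))
    refine ⟨A, hA, fun t ht ↦ ?_⟩
    exact notMem_empty _ (h ▸ mem_inter.2 ⟨ht, mem_image_of_mem x (mem_univ t)⟩)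
  have hhalf := half_le_iidProb_missedByHalf hp hε hmiss (by simpa using hk)
  obtain ⟨z, hz⟩ := exists_sum_iidProb_le_card hp univ
    fun (σ : Fin m → Bool) z ↦ MissedByHalf 𝒜 k (z ∘ swapHalves σ)
  have hcount : (#{σ : Fin m → Bool | MissedByHalf 𝒜 k (z ∘ swapHalves σ)} : ℝ) * 2 ^ k ≤
      (2 * m + 1) ^ 𝒜.vcDim * 2 ^ m := by
    exact_mod_cast Fintype.card_fin m ▸ card_missedByHalf_mul_two_pow_le z
  simp only [iidProb_comp_equiv (swapHalves _), sum_const, card_univ, Fintype.card_fun,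
    Fintype.card_bool, Fintype.card_fin, nsmul_eq_mul, Nat.cast_pow, Nat.cast_ofNat] at hz
  have hle : (2 : ℝ) ^ m * (1 / 2) * 2 ^ k ≤ (2 * m + 1) ^ 𝒜.vcDim * 2 ^ m :=
    (mul_le_mul_of_nonneg_right (le_trans (by gcongr) hz) (by positivity)).trans hcount
  have hle' : (1 / 2 : ℝ) * 2 ^ k ≤ (2 * m + 1) ^ 𝒜.vcDim :=
    le_of_mul_le_mul_left (by linarith) (by positivity : (0 : ℝ) < 2 ^ m)
  rw [pow_succ] at hk'
  linarith

end EpsilonNet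

/-! ### The theorem of Ding, Seymour and Winkler -/

section HittingSet

variable {ι α : Type*} [DecidableEq α] {B : ι → Finset α}

/-- Identify the pairs in `Fin n` with points of `S` and choose `f i` such that `B (f i)` contains
those points whose pair contains `i`. -/
theorem exists_privatelyIntersecting_of_shatters [Fintype ι] {S : Finset α}
    (hS : (univ.image B).Shatters S) {n : ℕ} (hn : n.choose 2 ≤ #S) :
    ∃ f : Fin n → ι, PrivatelyIntersecting (B ∘ f) univ := by
  let P := (univ : Finset (Fin n)).powersetCard 2
  obtain ⟨φ⟩ : Nonempty (P ↪ S) := Function.Embedding.nonempty_of_card_le <| by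
    simpa only [Fintype.card_coe, P, card_powersetCard, card_univ, Fintype.card_fin] using hn
  have htrace : ∀ i : Fin n, ∃ j, S ∩ B j = ({x : P | i ∈ x.1} : Finset P).image (φ · : P → α) := by
    intro i
    obtain ⟨_, hu, h⟩ := hS (t := ({x : P | i ∈ x.1} : Finset P).image (φ · : P → α)) fun a ha ↦ by
      obtain ⟨x, -, rfl⟩ := mem_image.1 ha
      exact (φ x).2
    obtain ⟨j, -, rfl⟩ := mem_image.1 hu
    exact ⟨j, h⟩
  choose f hf using htrace
  have hmem : ∀ (x : P) i, (φ x : α) ∈ B (f i) ↔ i ∈ x.1 := fun x i ↦ by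
    rw [← and_iff_right (φ x).2 (b := (φ x : α) ∈ B (f i)), ← mem_inter, hf]
    simp only [mem_image, Subtype.coe_inj, φ.injective.eq_iff, exists_eq_right, mem_filter_univ]
  refine ⟨f, fun i _ j _ hij ↦ ?_⟩
  refine ⟨φ ⟨{i, j}, mem_powersetCard.2 ⟨subset_univ _, card_pair hij⟩⟩, fun h _ ↦ ?_⟩
  simp [hmem]

theorem vcDim_image_lt_choose_two [Fintype ι] {d : ℕ} (hd : 2 ≤ d)
    (hK : ∀ K, PrivatelyIntersecting B K → #K ≤ d) :
    (univ.image B).vcDim < (d + 1).choose 2 := by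
  refine (Finset.sup_lt_iff (Nat.choose_pos (by omega))).2 fun S hS ↦ ?_
  by_contra! hcard
  obtain ⟨f, hf⟩ := exists_privatelyIntersecting_of_shatters (mem_shatterer.1 hS) hcard
  obtain ⟨L, hL, hLcard⟩ := hf.exists_card_eq (by simpa using by omega)
  have := hLcard ▸ hK L hL
  simp at this

theorem privatelyIntersecting_pair [DecidableEq ι] {i j : ι} (hij : (B i ∩ B j).Nonempty) :
    PrivatelyIntersecting B {i, j} := by
  obtain ⟨a, ha⟩ := hij
  rw [mem_inter] at ha
  intro i' hi' j' hj' hne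
  refine ⟨a, fun h hh ↦ ?_⟩
  simp only [mem_insert, mem_singleton] at hi' hj' hh
  grind

theorem four_pow_mul_cube_le_exp (u : ℕ) :
    (4 : ℝ) ^ u * (u ^ 3 * (45 / 256)) ≤ Real.exp (22 / 9 * u) := by
  have hlog : (1.05 : ℝ) ≤ 22 / 9 - 2 * Real.log 2 := by
    have := Real.log_two_lt_d9
    norm_num at this ⊢
    linarith
  have hcube : (u : ℝ) ^ 3 * (45 / 256) ≤ Real.exp (u * (22 / 9 - 2 * Real.log 2)) :=
    calc (u : ℝ) ^ 3 * (45 / 256) ≤ u ^ 3 * (1.05 ^ 3 / Nat.factorial 3) :=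
          mul_le_mul_of_nonneg_left (by norm_num [Nat.factorial]) (by positivity)
      _ = (u * 1.05) ^ 3 / Nat.factorial 3 := by rw [mul_pow, mul_div_assoc]
      _ ≤ Real.exp (u * 1.05) := Real.pow_div_factorial_le_exp _ (by positivity) 3
      _ ≤ _ := by gcongr
  have hfour : (4 : ℝ) ^ u = Real.exp (u * (2 * Real.log 2)) := by
    rw [Real.exp_nat_mul, mul_comm 2, Real.exp_mul, Real.exp_log two_pos]
    norm_num
  calc (4 : ℝ) ^ u * (u ^ 3 * (45 / 256))
      ≤ 4 ^ u * Real.exp (u * (22 / 9 - 2 * Real.log 2)) := by gcongr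
    _ = Real.exp (22 / 9 * u) := by rw [hfour, ← Real.exp_add]; congr 1; ring

theorem two_mul_two_mul_add_one_le_exp {d u R : ℕ} (hd : 2 ≤ d) (hdu : d ≤ u) (hR : 1 ≤ R)
    (hRu : 256 * R ^ 2 ≤ 4 ^ u) :
    2 * (2 * (11 * d ^ 2 * u * R ^ 2) + 1 : ℝ) ≤ Real.exp (22 / 9 * u) := by
  have hRu' : (R : ℝ) ^ 2 ≤ 4 ^ u / 256 := by
    rw [le_div_iff₀' (by norm_num)]
    exact_mod_cast hRu
  have hone : (2 : ℝ) ≤ d ^ 2 * u * R ^ 2 := by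
    norm_cast
    calc 2 ≤ 2 ^ 2 * 2 * 1 ^ 2 := by norm_num
      _ ≤ d ^ 2 * u * R ^ 2 := by gcongr; exact hd.trans hdu
  calc 2 * (2 * (11 * d ^ 2 * u * R ^ 2) + 1 : ℝ) ≤ 45 * (d ^ 2 * u * R ^ 2) := by linarith
    _ ≤ 45 * ((u : ℝ) ^ 2 * u * (4 ^ u / 256)) := by gcongr
    _ = 4 ^ u * (u ^ 3 * (45 / 256)) := by ring
    _ ≤ _ := four_pow_mul_cube_le_exp u

theorem sq_choose_mul_le_four_pow {d ν : ℕ} (h : 1 ≤ d + ν) :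
    256 * (d + ν).choose d ^ 2 ≤ 4 ^ (d + ν + 3) := by
  have hle : (d + ν).choose d ≤ 2 ^ (d + ν - 1) := by
    simpa only [Nat.sub_add_cancel h] using Nat.choose_succ_le_two_pow (d + ν - 1) d
  calc 256 * (d + ν).choose d ^ 2 ≤ 256 * (2 ^ (d + ν - 1)) ^ 2 := by gcongr
    _ = (2 ^ (d + ν - 1 + 4)) ^ 2 := by ring
    _ = (2 ^ (d + ν + 3)) ^ 2 := by congr 2; omega
    _ = 4 ^ (d + ν + 3) := by rw [← pow_mul, mul_comm, pow_mul]; norm_num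

theorem sixteen_mul_choose_two_le (d : ℕ) : 16 * (d + 1).choose 2 ≤ 9 * d ^ 2 + 16 := by
  have hchoose : 2 * (d + 1).choose 2 = d ^ 2 + d := by
    have := Nat.add_one_mul_choose_eq d 1
    rw [Nat.choose_one_right] at this
    linarith
  have hsq : 8 * d ≤ d ^ 2 + 16 := by
    zify
    nlinarith [sq_nonneg ((d : ℤ) - 4)]
  omega

theorem four_mul_pow_le_exp {d ν D : ℕ} (hd : 2 ≤ d) (hD : D < (d + 1).choose 2) :
    4 * (2 * (11 * d ^ 2 * (d + ν + 3) * (d + ν).choose d ^ 2 : ℕ) + 1 : ℝ) ^ D ≤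
      Real.exp (11 * d ^ 2 * (d + ν + 3) / 8) := by
  let u := d + ν + 3
  let R := (d + ν).choose d
  let b : ℝ := 2 * (11 * d ^ 2 * u * R ^ 2) + 1
  obtain ⟨D₀, hDD₀, hD₀, hDd⟩ : ∃ D₀, D ≤ D₀ ∧ 2 ≤ D₀ ∧ 16 * D₀ ≤ 9 * d ^ 2 := by
    have hlarge := sixteen_mul_choose_two_le d
    have hsmall : 3 ≤ (d + 1).choose 2 := Nat.choose_le_choose 2 (by omega : 3 ≤ d + 1)
    exact ⟨(d + 1).choose 2 - 1, by omega, by omega, by omega⟩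
  have hb : 2 * b ≤ Real.exp (22 / 9 * u) :=
    two_mul_two_mul_add_one_le_exp hd (by omega) (Nat.choose_pos (by omega))
      (sq_choose_mul_le_four_pow (by omega))
  have hb1 : 1 ≤ b := le_add_of_nonneg_left (by positivity)
  have hexponent : (D₀ * (22 / 9 * u) : ℝ) ≤ 11 * d ^ 2 * u / 8 := by
    have h : (16 * D₀ : ℝ) ≤ 9 * d ^ 2 := by exact_mod_cast hDd
    calc (D₀ * (22 / 9 * u) : ℝ) = 11 / 72 * (16 * D₀) * u := by ring
      _ ≤ 11 / 72 * (9 * d ^ 2) * u := by gcongr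
      _ = _ := by ring
  calc 4 * (2 * (11 * d ^ 2 * (d + ν + 3) * R ^ 2 : ℕ) + 1 : ℝ) ^ D
      = 2 ^ 2 * b ^ D := by simp only [b, u]; push_cast; norm_num
    _ ≤ 2 ^ D₀ * b ^ D₀ := by gcongr; norm_num
    _ = (2 * b) ^ D₀ := (mul_pow _ _ _).symm
    _ ≤ Real.exp (22 / 9 * u) ^ D₀ := by gcongr
    _ = Real.exp (D₀ * (22 / 9 * u)) := (Real.exp_nat_mul _ _).symm
    _ ≤ Real.exp (11 * d ^ 2 * u / 8) := Real.exp_le_exp.2 hexponent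
    _ = _ := by simp only [u]; push_cast; rfl

theorem exists_hittingSet_of_card_privatelyIntersecting_le_one [Finite ι]
    (hB : ∀ i, (B i).Nonempty) {d ν : ℕ} (hd : d ≤ 1)
    (hν : ∀ S : Finset ι, (S : Set ι).PairwiseDisjoint B → #S ≤ ν)
    (hK : ∀ K, PrivatelyIntersecting B K → #K ≤ d) :
    ∃ X : Finset α, #X ≤ d * ν ∧ ∀ i, (B i ∩ X).Nonempty := by
  classical
  have := Fintype.ofFinite ι
  have hdisjoint : ((univ : Finset ι) : Set ι).PairwiseDisjoint B := by
    intro i _ j _ hij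
    by_contra hmeet
    have := hK _ (privatelyIntersecting_pair (not_disjoint_iff_nonempty_inter.1 hmeet))
    rw [card_pair hij] at this
    omega
  choose x hx using hB
  refine ⟨univ.image x, ?_, fun i ↦ ⟨x i, by simp [hx]⟩⟩
  obtain rfl | rfl : d = 0 ∨ d = 1 := by omega
  · have hempty : IsEmpty ι := ⟨fun i ↦ by
      simpa using hK _ (privatelyIntersecting_pair (i := i) (j := i) ⟨x i, by simp [hx]⟩)⟩
    simp
  · simpa using card_image_le.trans (hν _ hdisjoint)

theorem exists_hittingSet_of_card_privatelyIntersecting_le [Finite ι] [Finite α]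
    (hB : ∀ i, (B i).Nonempty) {d ν : ℕ}
    (hν : ∀ S : Finset ι, (S : Set ι).PairwiseDisjoint B → #S ≤ ν)
    (hK : ∀ K, PrivatelyIntersecting B K → #K ≤ d) :
    ∃ X : Finset α, #X ≤ 11 * d ^ 2 * (d + ν + 3) * (d + ν).choose d ^ 2 ∧
      ∀ i, (B i ∩ X).Nonempty := by
  have := Fintype.ofFinite ι
  have := Fintype.ofFinite α
  rcases lt_or_ge d 2 with hd | hd
  · obtain ⟨X, hX, hit⟩ :=
      exists_hittingSet_of_card_privatelyIntersecting_le_one hB (Nat.le_of_lt_succ hd) hν hK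
    refine ⟨X, hX.trans ?_, hit⟩
    have hR : 1 ≤ (d + ν).choose d := Nat.choose_pos (by omega)
    calc d * ν ≤ d ^ 2 * (d + ν + 3) := by
          gcongr
          · exact Nat.le_self_pow two_ne_zero d
          · omega
      _ = 1 * d ^ 2 * (d + ν + 3) * 1 ^ 2 := by ring
      _ ≤ _ := by gcongr; norm_num
  rcases isEmpty_or_nonempty ι with hι | hι
  · exact ⟨∅, by simp, isEmptyElim⟩
  have hR : ((d + ν).choose d : ℝ) ≠ 0 := by exact_mod_cast (Nat.choose_pos (by omega)).ne'
  rcases exists_strategy_or_exists_strategy (fun i a ↦ if a ∈ B i then (1 : ℝ) else 0)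
    (1 / (4 * ((d + ν).choose d : ℝ) ^ 2)) with ⟨q, hq, hlt⟩ | ⟨p, hp, hle⟩
  · obtain ⟨K, hKB, hcard⟩ := exists_privatelyIntersecting_of_weights hd hB hν hq fun a ↦ by
      simpa [sum_filter] using (hlt a).le
    exact absurd (hK K hKB) (by omega)
  · obtain ⟨X, hX, hit⟩ := exists_card_le_forall_inter_nonempty (𝒜 := univ.image B) hp
      (fun A hA ↦ by
        obtain ⟨i, -, rfl⟩ := mem_image.1 hA
        simpa using hle i)
      (m := 11 * d ^ 2 * (d + ν + 3) * (d + ν).choose d ^ 2) (by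
        refine (four_mul_pow_le_exp hd (vcDim_image_lt_choose_two hd hK)).trans_eq ?_
        congr 1
        push_cast
        field_simp
        norm_num)
    exact ⟨X, hX, fun i ↦ hit _ (mem_image_of_mem B (mem_univ i))⟩

end HittingSet

end Combinatorics

section Hypergraph

variable {α β : Type*} {H : Hypergraph α} {H' : Hypergraph β}

theorem transversality_le_card {X : Finset α} (hX : H.IsHittingSet X) :
    H.transversality ≤ X.card :=
  Nat.sInf_le ⟨X, hX, rfl⟩

theorem card_le_packingNumber [Finite α] {M : Finset (Set α)} (hM : H.IsPacking M) :
    M.card ≤ H.packingNumber := by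
  have := Fintype.ofFinite (Set α)
  exact le_csSup ⟨Fintype.card (Set α), by rintro _ ⟨M, -, rfl⟩; exact M.card_le_univ⟩
    ⟨M, hM, rfl⟩

theorem packingNumber_le {n : ℕ} (h : ∀ M : Finset (Set α), H.IsPacking M → M.card ≤ n) :
    H.packingNumber ≤ n :=
  csSup_le' (by rintro _ ⟨M, hM, rfl⟩; exact h M hM)

theorem card_le_twoVCDim [Finite α] {X : Finset α} (hX : H.IsTwoShattered X) :
    X.card ≤ H.twoVCDim := by
  have := Fintype.ofFinite α
  exact le_csSup ⟨Fintype.card α, by rintro _ ⟨X, -, rfl⟩; exact X.card_le_univ⟩ ⟨X, hX, rfl⟩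

theorem twoVCDim_le {n : ℕ} (h : ∀ X : Finset α, H.IsTwoShattered X → X.card ≤ n) :
    H.twoVCDim ≤ n :=
  csSup_le' (by rintro _ ⟨X, hX, rfl⟩; exact h X hX)

theorem isTwoShattered_image {f : α → β} (hf : f.Injective)
    (hvertex : ∀ x ∈ H.vertexSet, f x ∈ H'.vertexSet)
    (hedge : ∀ e ∈ H.edgeSet, f '' e ∈ H'.edgeSet) {X : Set α} (hX : H.IsTwoShattered X) :
    H'.IsTwoShattered (f '' X) := by
  refine ⟨Set.image_subset_iff.2 fun x hx ↦ hvertex x (hX.1 hx), fun Y hY hcard ↦ ?_⟩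
  obtain ⟨Z, hZX, rfl⟩ := Set.subset_image_iff.1 hY
  obtain ⟨e, he, rfl⟩ := hX.2 Z hZX (by rwa [Set.ncard_image_of_injective Z hf] at hcard)
  exact ⟨f '' e, hedge e he, (Set.image_inter hf).symm⟩

theorem twoVCDim_le_of_injective [Finite β] {f : α → β} (hf : f.Injective)
    (hvertex : ∀ x ∈ H.vertexSet, f x ∈ H'.vertexSet)
    (hedge : ∀ e ∈ H.edgeSet, f '' e ∈ H'.edgeSet) : H.twoVCDim ≤ H'.twoVCDim := by
  classical
  refine twoVCDim_le fun X hX ↦ ?_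
  rw [← Finset.card_image_of_injective X hf]
  apply card_le_twoVCDim
  rw [Finset.coe_image]
  exact isTwoShattered_image hf hvertex hedge hX

end Hypergraph

/-! ### Hypergraphs of balls -/

section Balls

variable {V W : Type*} {G : SimpleGraph V} {l : ℕ}

theorem edist_hom_le {G' : SimpleGraph W} (f : G →g G') (u v : V) :
    G'.edist (f u) (f v) ≤ G.edist u v := by
  by_cases h : G.edist u v = ⊤
  · simp [h]
  · obtain ⟨p, hp⟩ := SimpleGraph.exists_walk_of_edist_ne_top h
    rw [← hp, ← p.length_map f]
    exact SimpleGraph.edist_le _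

theorem edist_iso_eq {G' : SimpleGraph W} (f : G ≃g G') (u v : V) :
    G'.edist (f u) (f v) = G.edist u v :=
  le_antisymm (edist_hom_le f.toHom u v) (by simpa using edist_hom_le f.symm.toHom (f u) (f v))

theorem image_distBall {G' : SimpleGraph W} (f : G ≃g G') (x : V) (k : ℕ) :
    f '' G.distBall x k = G'.distBall (f x) k := by
  ext y
  obtain ⟨y, rfl⟩ := f.surjective y
  simp [SimpleGraph.distBall, f.injective.mem_set_image, edist_iso_eq]

theorem exists_edist_le_of_edist_le_two_mul {u v : V} (h : G.edist u v ≤ (2 * l : ℕ)) :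
    ∃ w, G.edist u w ≤ l ∧ G.edist w v ≤ l := by
  obtain ⟨p, hp⟩ :=
    SimpleGraph.exists_walk_of_edist_ne_top (ne_top_of_le_ne_top (ENat.natCast_ne_top _) h)
  rw [← hp, Nat.cast_le] at h
  refine ⟨p.getVert l, (SimpleGraph.edist_le (p.take l)).trans ?_,
    (SimpleGraph.edist_le (p.drop l)).trans ?_⟩
  · rw [SimpleGraph.Walk.take_length]
    exact_mod_cast min_le_left _ _
  · rw [SimpleGraph.Walk.drop_length, Nat.cast_le]
    omega

theorem card_le_packingNumber_ballHypergraph [Finite V] {S : Finset V}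
    (hS : (S : Set V).PairwiseDisjoint fun x ↦ G.distBall x l) :
    S.card ≤ (G.ballHypergraph l).packingNumber := by
  classical
  have hself : ∀ x, x ∈ G.distBall x l := fun x ↦ by simp [SimpleGraph.distBall]
  have hinj : Set.InjOn (fun x ↦ G.distBall x l) S :=
    fun x hx y hy (hxy : G.distBall x l = G.distBall y l) ↦
      hS.elim_set hx hy x (hself x) (hxy ▸ hself x)
  rw [← Finset.card_image_of_injOn hinj]
  apply card_le_packingNumber
  rw [Finset.coe_image]
  refine ⟨by rintro _ ⟨x, -, rfl⟩; exact ⟨x, rfl⟩, ?_⟩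
  exact hinj.pairwiseDisjoint_image.2 hS

theorem packingNumber_ballHypergraph_le_one (h : G.ediam ≤ (2 * l : ℕ)) :
    (G.ballHypergraph l).packingNumber ≤ 1 := by
  refine packingNumber_le fun M hM ↦ Finset.card_le_one.2 fun e he e' he' ↦ ?_
  obtain ⟨x, rfl⟩ := hM.1 he
  obtain ⟨y, rfl⟩ := hM.1 he'
  obtain ⟨w, hxw, hwy⟩ :=
    exists_edist_le_of_edist_le_two_mul ((G.edist_le_ediam (u := x) (v := y)).trans h)
  rw [SimpleGraph.edist_comm] at hwy
  exact hM.2.elim he he' (Set.not_disjoint_iff.2 ⟨w, hxw, hwy⟩)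

theorem isTwoShattered_ballHypergraph_iff {X : Set V} :
    (G.ballHypergraph l).IsTwoShattered X ↔
      ∀ x ∈ X, ∀ y ∈ X, x ≠ y → ∃ z, ∀ w ∈ X, G.edist z w ≤ l ↔ w = x ∨ w = y := by
  refine ⟨fun hX x hx y hy hxy ↦ ?_, fun h ↦ ⟨Set.subset_univ X, fun Y hY hcard ↦ ?_⟩⟩
  · obtain ⟨_, ⟨z, rfl⟩, hz⟩ := hX.2 {x, y} (Set.pair_subset hx hy) (Set.ncard_pair hxy)
    exact ⟨z, fun w hw ↦ by simpa [hw, SimpleGraph.distBall] using Set.ext_iff.1 hz w⟩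
  · obtain ⟨x, y, hxy, rfl⟩ := Set.ncard_eq_two.1 hcard
    rw [Set.pair_subset_iff] at hY
    obtain ⟨z, hz⟩ := h x hY.1 y hY.2 hxy
    refine ⟨_, ⟨z, rfl⟩, Set.ext fun w ↦ ?_⟩
    by_cases hw : w ∈ X
    · simpa [hw, SimpleGraph.distBall] using hz w hw
    · simp only [hw, and_false, Set.mem_inter_iff, false_iff]
      rintro (rfl | rfl)
      exacts [hw hY.1, hw hY.2]

theorem twoVCDim_ballHypergraph_le_distTwoVCDim [Finite V] (G : SimpleGraph V) (l : ℕ) :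
    (G.ballHypergraph l).twoVCDim ≤ G.distTwoVCDim := by
  have hle : (G.ballHypergraph l).twoVCDim ≤
      (G.induce Set.univ).allBallsHypergraph.twoVCDim := by
    refine twoVCDim_le_of_injective G.induceUnivIso.symm.injective (fun _ _ ↦ trivial) ?_
    rintro _ ⟨x, rfl⟩
    exact ⟨_, l, image_distBall _ x l⟩
  exact hle.trans (le_ciSup (Set.finite_range fun S : Set V ↦
    (G.induce S).allBallsHypergraph.twoVCDim).bddAbove Set.univ)

theorem twoVCDim_ballHypergraph_le_four_of_isPlanar (hG : G.IsPlanar) (l : ℕ) :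
    (G.ballHypergraph l).twoVCDim ≤ 4 := by
  refine twoVCDim_le fun X hX ↦ ?_
  rw [isTwoShattered_ballHypergraph_iff] at hX
  by_contra! hcard
  obtain ⟨x⟩ : Nonempty (Fin 5 ↪ X) :=
    Function.Embedding.nonempty_of_card_le (by simpa [Nat.succ_le_iff] using hcard)
  refine not_forall_exists_edist_le_iff_of_isPlanar hG l (fun i ↦ x i) fun i j hij ↦ ?_
  obtain ⟨z, hz⟩ := hX (x i) (x i).2 (x j) (x j).2 (by simpa [Subtype.coe_inj] using hij)
  exact ⟨z, fun h ↦ by simpa [Subtype.coe_inj] using hz (x h) (x h).2⟩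

theorem exists_isHittingSet_ballHypergraph [Finite V] {d ν : ℕ}
    (hd : (G.ballHypergraph l).twoVCDim ≤ d) (hν : (G.ballHypergraph l).packingNumber ≤ ν) :
    ∃ X : Finset V, (G.ballHypergraph l).IsHittingSet X ∧
      X.card ≤ 11 * d ^ 2 * (d + ν + 3) * (d + ν).choose d ^ 2 := by
  classical
  have := Fintype.ofFinite V
  let B : V → Finset V := fun x ↦ (G.distBall x l).toFinset
  have hmem : ∀ x y, y ∈ B x ↔ G.edist x y ≤ l := fun _ _ ↦ Set.mem_toFinset
  have hdisjoint : ∀ S : Finset V, (S : Set V).PairwiseDisjoint B → S.card ≤ ν :=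
    fun S hS ↦ (card_le_packingNumber_ballHypergraph fun x hx y hy hxy ↦
      Set.disjoint_toFinset.1 (hS hx hy hxy)).trans hν
  have hprivate : ∀ K, PrivatelyIntersecting B K → K.card ≤ d := fun K hK ↦ by
    refine (card_le_twoVCDim (isTwoShattered_ballHypergraph_iff.2 fun x hx y hy hxy ↦ ?_)).trans hd
    obtain ⟨z, hz⟩ := hK x hx y hy hxy
    exact ⟨z, fun w hw ↦ by
      rw [SimpleGraph.edist_comm, ← hmem, hz w hw]⟩
  obtain ⟨X, hcard, hX⟩ := exists_hittingSet_of_card_privatelyIntersecting_le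
    (fun x ↦ ⟨x, by simp [hmem]⟩) hdisjoint hprivate
  refine ⟨X, ⟨Set.subset_univ _, ?_⟩, hcard⟩
  rintro _ ⟨x, rfl⟩
  obtain ⟨y, hy⟩ := hX x
  exact ⟨y, by simpa [B] using hy⟩

theorem isDominatingAt_of_isHittingSet {D : Set V} (hD : (G.ballHypergraph l).IsHittingSet D) :
    G.IsDominatingAt l D := fun v ↦ by
  obtain ⟨x, hvx, hx⟩ := hD.2 _ ⟨v, rfl⟩
  exact ⟨x, hx, by rwa [SimpleGraph.edist_comm]⟩

end Balls

open Polynomial in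
theorem exists_polynomial_eval_eq (d : ℕ) : ∃ p : ℚ[X], p.natDegree ≤ 2 * d + 1 ∧
    ∀ n : ℕ, p.eval (n : ℚ) = ((11 * d ^ 2 * (d + n + 3) * (d + n).choose d ^ 2 : ℕ) : ℚ) := by
  refine ⟨C (11 * d ^ 2 : ℚ) * (X + C (d + 3 : ℚ)) * preHilbertPoly ℚ d 0 ^ 2, ?_, fun n ↦ ?_⟩
  · have hlinear : (C (11 * d ^ 2 : ℚ) * (X + C (d + 3 : ℚ))).natDegree ≤ 1 :=
      (natDegree_C_mul_le _ _).trans (natDegree_X_add_C _).le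
    have hsq : (preHilbertPoly ℚ d 0 ^ 2).natDegree ≤ 2 * d :=
      natDegree_pow_le.trans (by rw [natDegree_preHilbertPoly])
    exact natDegree_mul_le.trans (by omega)
  · have hchoose : (preHilbertPoly ℚ d 0).eval (n : ℚ) = (d + n).choose d := by
      rw [add_comm d n]
      simpa using preHilbertPoly_eq_choose_sub_add ℚ d (Nat.zero_le n)
    simp only [eval_mul, eval_pow, eval_add, eval_X, eval_C, hchoose]
    push_cast
    ring

theorem corollary4p2_general {V : Type*} [Finite V] (G : SimpleGraph V) :
    (∀ d l : ℕ, (G.ballHypergraph l).twoVCDim ≤ d →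
      (G.ballHypergraph l).transversality ≤
        11 * d ^ 2 * (d + (G.ballHypergraph l).packingNumber + 3) *
          (d + (G.ballHypergraph l).packingNumber).choose d ^ 2) ∧
    (∀ d : ℕ, ∃ p : Polynomial ℚ, p.natDegree ≤ 2 * d + 1 ∧
      ∀ n : ℕ, p.eval (n : ℚ) =
        ((11 * d ^ 2 * (d + n + 3) * (d + n).choose d ^ 2 : ℕ) : ℚ)) ∧
    (∀ l ν : ℕ, G.IsPlanar → (G.ballHypergraph l).packingNumber ≤ ν →
      ∃ D : Finset V, G.IsDominatingAt l ↑D ∧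
        D.card ≤ 11 * 4 ^ 2 * (4 + ν + 3) * (4 + ν).choose 4 ^ 2) := by
  refine ⟨fun d l hd ↦ ?_, exists_polynomial_eval_eq, fun l ν hG hν ↦ ?_⟩
  · obtain ⟨X, hX, hcard⟩ := exists_isHittingSet_ballHypergraph hd le_rfl
    exact (transversality_le_card hX).trans hcard
  · obtain ⟨D, hD, hcard⟩ := exists_isHittingSet_ballHypergraph
      (twoVCDim_ballHypergraph_le_four_of_isPlanar hG l) hν
    exact ⟨D, isDominatingAt_of_isHittingSet hD, hcard⟩

theorem corollary4p2 {V : Type*} [Finite V] (G : SimpleGraph V) :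
    (∀ d l : ℕ, G.distTwoVCDim ≤ d →
      (G.ballHypergraph l).transversality ≤
        11 * d ^ 2 * (d + (G.ballHypergraph l).packingNumber + 3) *
          (d + (G.ballHypergraph l).packingNumber).choose d ^ 2) ∧
    (∀ d : ℕ, ∃ p : Polynomial ℚ, p.natDegree ≤ 2 * d + 1 ∧
      ∀ n : ℕ, p.eval (n : ℚ) =
        ((11 * d ^ 2 * (d + n + 3) * (d + n).choose d ^ 2 : ℕ) : ℚ)) ∧
    (∀ l : ℕ, G.IsPlanar → G.ediam ≤ ((2 * l : ℕ) : ℕ∞) →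
      ∃ D : Finset V, G.IsDominatingAt l ↑D ∧ D.card ≤ 35200) :=
  have ⟨hτ, hpoly, hplanar⟩ := corollary4p2_general G
  ⟨fun d l hd ↦ hτ d l ((twoVCDim_ballHypergraph_le_distTwoVCDim G l).trans hd), hpoly,
    fun l hG hl ↦ hplanar l 1 hG (packingNumber_ballHypergraph_le_one hl)⟩
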